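/- Let $A\in\mathbb C^{m\times n}$ and let $B,C\in\mathbb C^{m\times m}$ be Hermitian. For Hermitian $P,Q$ write $P\succcurlyeq Q$ (resp. $P\succ Q$) if $P-Q$ is positive semidefinite (resp. positive definite); let $r(\cdot)$ denote rank, and let $i_+(\cdot)$, $i_-(\cdot)$ denote the numbers of positive and negative eigenvalues of a Hermitian matrix, counted with multiplicity. Assume that $$\mathcal S_1=\{X\in\mathbb C^{n\times m} : AX+(AX)^*\succcurlyeq B\}$$ is non-empty, and put $$N=\begin{bmatrix} C & A\\ A^* & 0\end{bmatrix},\qquad K_1=\begin{bmatrix} B & C & A\\ A^* & 0 & 0\\ 0 & A^* & 0\end{bmatrix},\qquad K_2=\begin{bmatrix} B & C & A\\ A^* & A^* & 0\end{bmatrix}.$$ Then the following extrema are attained and have the stated values: $$\max_{X\in\mathcal S_1} r[AX+(AX)^*-C]=\min\{r(K_2)-r(A),\ r(N)\},$$ $$\min_{X\in\mathcal S_1} r[AX+(AX)^*-C]=\max\{t_1,t_2,t_3,t_4\},$$ $$\max_{X\in\mathcal S_1} i_+[AX+(AX)^*-C]=i_-(N),$$ $$\max_{X\in\mathcal S_1}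 i_-[AX+(AX)^*-C]=\min\{i_-(B-C),\ i_+(N)\},$$ $$\min_{X\in\mathcal S_1} i_+[AX+(AX)^*-C]=\max\{r(K_2)+i_-(N)-r(K_1),\ r(K_2)+i_+(B-C)-r[A,\,B-C]-r(A)\},$$ $$\min_{X\in\mathcal S_1} i_-[AX+(AX)^*-C]=\max\{r(K_2)+i_+(N)-r(K_1),\ r(K_2)+i_-(B-C)-r[A,\,B-C]-r(A)-m\},$$ where $$t_1=2r(K_2)+r(N)-2r(K_1),$$ $$t_2=2r(K_2)+r(B-C)-2r[A,\,B-C]-2r(A)-m,$$ $$t_3=2r(K_2)+i_+(N)+i_+(B-C)-r(A)-r[A,\,B-C]-r(K_1),$$ $$t_4=2r(K_2)+i_-(N)+i_-(B-C)-r(A)-r[A,\,B-C]-r(K_1)-m.$$ Consequently (still assuming $\mathcal S_1\neq\emptyset$): (a) there is $X\in\mathbb C^{n\times m}$ with $C\succ AX+(AX)^*\succcurlyeq B$ if and only if $i_+(N)\ge m$ and $C\succ B$; (b) there is $X\in\mathbb C^{n\times m}$ with $AX+(AX)^*\succcurlyeq B$ and $AX+(AX)^*\succ C$ if and only if $i_-(N)\ge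 m$; (c) there is $X\in\mathbb C^{n\times m}$ with $AX+(AX)^*\succcurlyeq B$ and $AX+(AX)^*\succcurlyeq C$ if and only if $r(K_2)+i_+(N)-r(K_1)=0$ and $r(K_2)+i_-(B-C)\le r[A,\,B-C]+r(A)+m$; (d) there is $X\in\mathbb C^{n\times m}$ with $C\succcurlyeq AX+(AX)^*\succcurlyeq B$ if and only if $C\succcurlyeq B$, $i_-(N)=r(A)$ and $r(K_2)=r[A,\,B-C]+r(A)$. -/

import Mathlib

noncomputable section

namespace LMI

open Matrix
open scoped ComplexOrder

open Classical in
/-- `i₊(M)`: the number of eigenvalues of `M` with positive real part, counted with (algebraic)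
multiplicity. For a Hermitian `M` all eigenvalues are real, so this is the number of positive
eigenvalues counted with multiplicity; see `posInertia_eq_card`. -/
def posInertia {ι : Type*} [Fintype ι] [DecidableEq ι] (M : Matrix ι ι ℂ) : ℕ :=
  M.charpoly.roots.countP (fun z => 0 < z.re)

open Classical in
/-- `i₋(M)`: the number of eigenvalues of `M` with negative real part, counted with (algebraic)
multiplicity. For a Hermitian `M` this is the number of negative eigenvalues counted with
multiplicity; see `negInertia_eq_card`. -/
def negInertia {ι : Type*} [Fintype ι] [DecidableEq ι] (M : Matrix ι ι ℂ) : ℕ :=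
  M.charpoly.roots.countP (fun z => z.re < 0)

theorem posInertia_eq_card {ι : Type*} [Fintype ι] [DecidableEq ι] {M : Matrix ι ι ℂ}
    (hM : M.IsHermitian) : posInertia M = Fintype.card {i // 0 < hM.eigenvalues i} := by
  classical
  rw [posInertia, hM.roots_charpoly_eq_eigenvalues, Multiset.countP_map, Fintype.card_subtype]
  simp [Finset.card, Finset.filter]

theorem negInertia_eq_card {ι : Type*} [Fintype ι] [DecidableEq ι] {M : Matrix ι ι ℂ}
    (hM : M.IsHermitian) : negInertia M = Fintype.card {i // hM.eigenvalues i < 0} := by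
  classical
  rw [negInertia, hM.roots_charpoly_eq_eigenvalues, Multiset.countP_map, Fintype.card_subtype]
  simp [Finset.card, Finset.filter]

/-- `P ≽ Q` in the Löwner partial ordering. -/
def LoewnerGE {m : ℕ} (P Q : Matrix (Fin m) (Fin m) ℂ) : Prop := (P - Q).PosSemidef

/-- `P ≻ Q` in the Löwner partial ordering. -/
def LoewnerGT {m : ℕ} (P Q : Matrix (Fin m) (Fin m) ℂ) : Prop := (P - Q).PosDef

/-- `A X + (A X)*`. -/
def lyap {m n : ℕ} (A : Matrix (Fin m) (Fin n) ℂ) (X : Matrix (Fin n) (Fin m) ℂ) :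
    Matrix (Fin m) (Fin m) ℂ := A * X + (A * X)ᴴ

/-- The solution set `{X | A X + (A X)* ≽ B}`. -/
def solSet {m n : ℕ} (A : Matrix (Fin m) (Fin n) ℂ) (B : Matrix (Fin m) (Fin m) ℂ) :
    Set (Matrix (Fin n) (Fin m) ℂ) := {X | LoewnerGE (lyap A X) B}

/-- `N = [[C, A], [A*, 0]]`. -/
def matN {m n : ℕ} (A : Matrix (Fin m) (Fin n) ℂ) (C : Matrix (Fin m) (Fin m) ℂ) :
    Matrix (Fin m ⊕ Fin n) (Fin m ⊕ Fin n) ℂ := fromBlocks C A Aᴴ 0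

/-- `K₁ = [[B, C, A], [A*, 0, 0], [0, A*, 0]]`. -/
def matK₁ {m n : ℕ} (A : Matrix (Fin m) (Fin n) ℂ) (B C : Matrix (Fin m) (Fin m) ℂ) :
    Matrix (Fin m ⊕ (Fin n ⊕ Fin n)) (Fin m ⊕ (Fin m ⊕ Fin n)) ℂ :=
  fromRows (fromCols B (fromCols C A))
    (fromRows (fromCols Aᴴ (fromCols 0 0)) (fromCols 0 (fromCols Aᴴ 0)))

/-- `K₂ = [[B, C, A], [A*, A*, 0]]`. -/
def matK₂ {m n : ℕ} (A : Matrix (Fin m) (Fin n) ℂ) (B C : Matrix (Fin m) (Fin m) ℂ) :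
    Matrix (Fin m ⊕ Fin n) (Fin m ⊕ (Fin m ⊕ Fin n)) ℂ :=
  fromRows (fromCols B (fromCols C A)) (fromCols Aᴴ (fromCols Aᴴ 0))

/-- The rank as an integer, so that differences of ranks are not truncated. -/
def rk {ι κ : Type*} [Fintype ι] [Fintype κ] (M : Matrix ι κ ℂ) : ℤ := (M.rank : ℤ)

/-- `i₊` as an integer. -/
def iPos {ι : Type*} [Fintype ι] [DecidableEq ι] (M : Matrix ι ι ℂ) : ℤ := (posInertia M : ℤ)

/-- `i₋` as an integer. -/
def iNeg {ι : Type*} [Fintype ι] [DecidableEq ι] (M : Matrix ι ι ℂ) : ℤ := (negInertia M : ℤ)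

end LMI

end

/-! Put U = ker A*, of codimension a = r(A). The Hermitian matrices AX + (AX)* are exactly those
whose form vanishes on U. Hence, with D the form of B - C and E that of -C, the forms M of AX +
(AX)* - C with X in the solution set are exactly the Hermitian forms that agree with E on U and
dominate D everywhere (`isExtension_of_mem_solSet`, `exists_mem_solSet`). The question becomes which
indices such dominating extensions can have, given only that D ≤ E on U.

Let p, q, κ be the positive index, negative index and nullity of E on U, let d, e be the positive
and negative index of D, and write u₀ = dim(rad E|U ∩ rad D), u₁ = dim(U ∩ rad D), u₂ = dim(rad E|U
∩ rad D|U). These determine every quantity in the statement: r(K₁) = m + 2a - u₂, r(K₂) = m + a -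
u₀, r[A, B-C] = m - u₁, i₊(N) = a + q, i₋(N) = a + p.

Every extension satisfies max(p + u₂, d + u₁) - u₀ ≤ i₊(M) ≤ a + p, q + u₂ - u₀ ≤ i₋(M) ≤ min(e, a +
q) and r(M) ≤ m - u₀. The lower bounds rest on one fact: a vector null for the nonnegative form M -
D lies in its radical, so M and D agree against it.

The bounds are attained by extending U one vector v at a time. `exists_extension_step` makes the gap
M - D the orthogonal sum of E - D on U and a free number q ≥ 0 on v; each extremum is a strategy for
choosing v and q (`exists_extension_posIdx_ge`, `exists_extension_negIdx_ge`,
`exists_extension_idx_le`). One X minimises both indices, so the minimal rank is the sum of the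
minimal indices; one X also maximises i₊ and the rank together. The terms containing -m never exceed
the others, because e + u₁ ≤ m. -/

namespace LMI

open Module

/-! ### Indices and radicals of Hermitian forms on subspaces -/

section Forms

variable {V : Type*} [AddCommGroup V] [Module ℂ V]

/-- Sesquilinear forms, conjugate-linear in the first variable. -/
abbrev Form (V : Type*) [AddCommGroup V] [Module ℂ V] := V →ₗ⋆[ℂ] V →ₗ[ℂ] ℂ

/-- The form `D` is Hermitian. -/
def IsHerm (D : Form V) : Prop := ∀ x y, D x y = star (D y x)

/-- The form `D` is positive definite on the subspace `W`. -/
def IsPosOn (D : Form V) (W : Submodule ℂ V) : Prop := ∀ x ∈ W, x ≠ 0 → 0 < (D x x).re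

/-- The largest dimension of a subspace of `U` on which `D` is positive definite. -/
noncomputable def posIdx (D : Form V) (U : Submodule ℂ V) : ℕ :=
  sSup {k | ∃ W ≤ U, IsPosOn D W ∧ finrank ℂ W = k}

/-- The radical of the restriction of `D` to `U`. -/
def rad (D : Form V) (U : Submodule ℂ V) : Submodule ℂ V where
  carrier := {x | x ∈ U ∧ ∀ u ∈ U, D x u = 0}
  add_mem' := by
    rintro x y ⟨hx, hx'⟩ ⟨hy, hy'⟩
    exact ⟨U.add_mem hx hy, fun u hu => by simp [hx' u hu, hy' u hu]⟩
  zero_mem' := ⟨U.zero_mem, fun u _ => by simp⟩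
  smul_mem' := by
    rintro c x ⟨hx, hx'⟩
    exact ⟨U.smul_mem c hx, fun u hu => by simp [hx' u hu]⟩

theorem mem_rad {D : Form V} {U : Submodule ℂ V} {x : V} :
    x ∈ rad D U ↔ x ∈ U ∧ ∀ u ∈ U, D x u = 0 := Iff.rfl

theorem rad_le (D : Form V) (U : Submodule ℂ V) : rad D U ≤ U := fun _ hx => hx.1

theorem IsHerm.neg {D : Form V} (hD : IsHerm D) : IsHerm (-D) := fun x y => by
  simp [hD x y]

theorem IsHerm.add {D E : Form V} (hD : IsHerm D) (hE : IsHerm E) : IsHerm (D + E) :=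
  fun x y => by simp [hD x y, hE x y]

theorem IsHerm.sub {D E : Form V} (hD : IsHerm D) (hE : IsHerm E) : IsHerm (D - E) :=
  fun x y => by simp [hD x y, hE x y]

theorem IsHerm.swap_eq_zero {D : Form V} (hD : IsHerm D) {x y : V} (h : D x y = 0) :
    D y x = 0 := by rw [hD, h, star_zero]

theorem IsHerm.re_swap {D : Form V} (hD : IsHerm D) (x y : V) :
    (D y x).re = (D x y).re := by
  rw [hD y x]; simp

theorem IsHerm.apply_self {D : Form V} (hD : IsHerm D) (x : V) :
    D x x = ((D x x).re : ℂ) := by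
  have := congrArg Complex.im (hD x x)
  apply Complex.ext <;> simp at this ⊢
  linarith

theorem IsHerm.re_add {D : Form V} (hD : IsHerm D) (x y : V) :
    (D (x + y) (x + y)).re = (D x x).re + (D y y).re + 2 * (D x y).re := by
  have := hD.re_swap x y
  simp only [map_add, LinearMap.add_apply, Complex.add_re]
  linarith

theorem re_smul (D : Form V) (c : ℂ) (x : V) :
    (D (c • x) (c • x)).re = Complex.normSq c * (D x x).re := by
  have : D (c • x) (c • x) = ((Complex.normSq c : ℝ) : ℂ) * D x x := by
    rw [Complex.normSq_eq_conj_mul_self]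
    simp only [map_smulₛₗ, LinearMap.smul_apply, smul_eq_mul, RingHom.id_apply]
    ring
  rw [this, Complex.re_ofReal_mul]

theorem IsPosOn.mono {D : Form V} {W W' : Submodule ℂ V} (h : IsPosOn D W) (hW : W' ≤ W) :
    IsPosOn D W' := fun x hx => h x (hW hx)

/-- A Hermitian form that is nonnegative on `U` pairs its null vectors in `U` to zero. -/
theorem IsHerm.eq_zero_of_null {Z : Form V} (hZ : IsHerm Z) {U : Submodule ℂ V}
    (hpos : ∀ x ∈ U, 0 ≤ (Z x x).re) {x y : V} (hx : x ∈ U) (hy : y ∈ U)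
    (h0 : (Z x x).re ≤ 0) : Z x y = 0 := by
  have h0' : (Z x x).re = 0 := le_antisymm h0 (hpos x hx)
  by_contra hne
  have hn : 0 < Complex.normSq (Z x y) := Complex.normSq_pos.2 hne
  -- With this `t` the value at -t·Z(x,y)·x + y is Z(y,y) - 2t|Z(x,y)|² = -1, against nonnegativity.
  set t : ℝ := ((Z y y).re + 1) / (2 * Complex.normSq (Z x y)) with ht
  have h := hpos (((-t : ℝ) : ℂ) • (Z x y) • x + y)
    (U.add_mem (U.smul_mem _ (U.smul_mem _ hx)) hy)
  rw [hZ.re_add, re_smul, re_smul, h0'] at h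
  have e : (Z (((-t : ℝ) : ℂ) • (Z x y) • x) y).re = -t * Complex.normSq (Z x y) := by
    rw [map_smulₛₗ, map_smulₛₗ, LinearMap.smul_apply, LinearMap.smul_apply, smul_eq_mul,
      smul_eq_mul, ← Complex.normSq_eq_conj_mul_self]
    simp
  rw [e] at h
  have : t * (2 * Complex.normSq (Z x y)) = (Z y y).re + 1 := by
    rw [ht]; field_simp
  nlinarith

/-- Cauchy–Schwarz for the nonnegative gap M - D. It transfers radical vectors between a form and
any form dominating it. -/
theorem form_ext_re {D M : Form V} (hD : IsHerm D) (hM : IsHerm M)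
    {U : Submodule ℂ V} (h : ∀ x ∈ U, (D x x).re ≤ (M x x).re) {x y : V}
    (hx : x ∈ U) (hy : y ∈ U) (h0 : (M x x).re ≤ (D x x).re) : M x y = D x y := by
  have := (hM.sub hD).eq_zero_of_null (U := U) (fun z hz => by simpa using h z hz) hx hy
    (by simpa using h0)
  simpa [sub_eq_zero] using this

/-- The vectors that are orthogonal to `W`. -/
def orth (D : Form V) (W : Submodule ℂ V) : Submodule ℂ V where
  carrier := {x | ∀ w ∈ W, D w x = 0}
  add_mem' := by
    intro x y hx hy w hw
    simp [hx w hw, hy w hw]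
  zero_mem' := by simp
  smul_mem' := by
    intro c x hx w hw
    simp [hx w hw]

theorem mem_sup_span_singleton {U : Submodule ℂ V} {v x : V} :
    x ∈ U ⊔ Submodule.span ℂ {v} ↔ ∃ u ∈ U, ∃ c : ℂ, x = u + c • v := by
  simp only [Submodule.mem_sup, Submodule.mem_span_singleton]
  constructor
  · rintro ⟨u, hu, _, ⟨c, rfl⟩, rfl⟩; exact ⟨u, hu, c, rfl⟩
  · rintro ⟨u, hu, c, rfl⟩; exact ⟨u, hu, _, ⟨c, rfl⟩, rfl⟩

theorem re_add_smul_of_orth {E : Form V} (hE : IsHerm E) {u v : V} (h : E u v = 0) (c : ℂ) :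
    (E (u + c • v) (u + c • v)).re = (E u u).re + Complex.normSq c * (E v v).re := by
  rw [hE.re_add, re_smul, map_smul, h]
  simp

variable [FiniteDimensional ℂ V]

theorem bddAbove_posIdx (D : Form V) (U : Submodule ℂ V) :
    BddAbove {k | ∃ W ≤ U, IsPosOn D W ∧ finrank ℂ W = k} := by
  refine ⟨finrank ℂ U, ?_⟩
  rintro k ⟨W, hW, -, rfl⟩
  exact Submodule.finrank_mono hW

theorem le_posIdx {D : Form V} {U W : Submodule ℂ V} (hW : W ≤ U) (h : IsPosOn D W) :
    finrank ℂ W ≤ posIdx D U := le_csSup (bddAbove_posIdx D U) ⟨W, hW, h, rfl⟩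

theorem exists_posIdx (D : Form V) (U : Submodule ℂ V) :
    ∃ W ≤ U, IsPosOn D W ∧ finrank ℂ W = posIdx D U :=
  Nat.sSup_mem (s := {k | ∃ W ≤ U, IsPosOn D W ∧ finrank ℂ W = k})
    ⟨0, ⊥, bot_le, by intro x hx hx0; exact absurd ((Submodule.mem_bot ℂ).1 hx) hx0,
      finrank_bot ℂ V⟩ (bddAbove_posIdx D U)

theorem posIdx_le {D : Form V} {U : Submodule ℂ V} {k : ℕ}
    (h : ∀ W ≤ U, IsPosOn D W → finrank ℂ W ≤ k) : posIdx D U ≤ k := by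
  obtain ⟨W, hW, hp, e⟩ := exists_posIdx D U
  exact e ▸ h W hW hp

theorem posIdx_mono (D : Form V) {U U' : Submodule ℂ V} (h : U ≤ U') :
    posIdx D U ≤ posIdx D U' :=
  posIdx_le fun _ hW hp => le_posIdx (hW.trans h) hp

theorem posIdx_mono_form {D E : Form V} {U : Submodule ℂ V}
    (h : ∀ x ∈ U, (D x x).re ≤ (E x x).re) : posIdx D U ≤ posIdx E U :=
  posIdx_le fun _ hW hp => le_posIdx hW fun x hx h0 => (hp x hx h0).trans_le (h x (hW hx))

theorem exists_ne_zero_of_finrank_lt {W W' U : Submodule ℂ V} (hW : W ≤ U) (hW' : W' ≤ U)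
    (h : finrank ℂ U < finrank ℂ W + finrank ℂ W') : ∃ x ∈ W, x ∈ W' ∧ x ≠ 0 := by
  have h1 := Submodule.finrank_sup_add_finrank_inf_eq W W'
  have h2 := Submodule.finrank_mono (sup_le hW hW')
  have h3 : W ⊓ W' ≠ ⊥ := by
    intro h0
    rw [h0, finrank_bot] at h1
    omega
  obtain ⟨x, hx, hx0⟩ := Submodule.exists_mem_ne_zero_of_ne_bot h3
  exact ⟨x, hx.1, hx.2, hx0⟩

theorem posIdx_add_finrank_le {D : Form V} {U U' : Submodule ℂ V} (h : U ≤ U') :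
    posIdx D U' + finrank ℂ U ≤ posIdx D U + finrank ℂ U' := by
  obtain ⟨W, hW, hp, e⟩ := exists_posIdx D U'
  have h1 := Submodule.finrank_sup_add_finrank_inf_eq W U
  have h2 := Submodule.finrank_mono (sup_le hW h)
  have h3 := le_posIdx (D := D) (inf_le_right : W ⊓ U ≤ U) (hp.mono inf_le_left)
  omega

/-- Semidefinite subspaces bound the index. -/
theorem posIdx_add_finrank_le_of_nonpos {D : Form V} {U N : Submodule ℂ V} (hN : N ≤ U)
    (h : ∀ x ∈ N, (D x x).re ≤ 0) : posIdx D U + finrank ℂ N ≤ finrank ℂ U := by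
  obtain ⟨W, hW, hp, e⟩ := exists_posIdx D U
  by_contra! hlt
  obtain ⟨x, h1, h2, h3⟩ := exists_ne_zero_of_finrank_lt hW hN (by omega)
  exact absurd (hp x h1 h3) (not_lt.2 (h x h2))

theorem finrank_map_add_finrank_inf_ker {F : Type*} [AddCommGroup F] [Module ℂ F]
    (g : V →ₗ[ℂ] F) (U : Submodule ℂ V) :
    finrank ℂ (U.map g) + finrank ℂ (U ⊓ LinearMap.ker g : Submodule ℂ V) = finrank ℂ U := by
  have h := LinearMap.finrank_range_add_finrank_ker (g.domRestrict U)
  have e : finrank ℂ (U ⊓ LinearMap.ker g : Submodule ℂ V)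
      = finrank ℂ (LinearMap.ker (g.domRestrict U)) := by
    rw [← Submodule.finrank_map_subtype_eq U (LinearMap.ker (g.domRestrict U))]
    have : U ⊓ LinearMap.ker g
        = (LinearMap.ker (g.domRestrict U)).map U.subtype := by
      ext x
      simp [and_comm]
    rw [this]
  rw [e, ← h, LinearMap.range_domRestrict]

theorem finrank_le_inf_ker_add {F : Type*} [AddCommGroup F] [Module ℂ F]
    [FiniteDimensional ℂ F] (g : V →ₗ[ℂ] F) (U : Submodule ℂ V) :
    finrank ℂ U ≤ finrank ℂ (U ⊓ LinearMap.ker g : Submodule ℂ V) + finrank ℂ F := by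
  have h := finrank_map_add_finrank_inf_ker g U
  have := Submodule.finrank_le (U.map g)
  omega

theorem exists_pairing (D : Form V) (W : Submodule ℂ V) :
    ∃ g : V →ₗ[ℂ] (Fin (finrank ℂ W) → ℂ),
      (∀ x, g x = 0 ↔ x ∈ orth D W) := by
  let b := finBasis ℂ W
  refine ⟨LinearMap.pi fun i => D (b i), fun x => ⟨fun h w hw => ?_, fun h => ?_⟩⟩
  · have : ∀ i, D (b i) x = 0 := fun i => congrFun h i
    have e := congrArg (Submodule.subtype W) (b.sum_repr ⟨w, hw⟩)
    rw [map_sum] at e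
    have e' : w = ∑ i, b.repr ⟨w, hw⟩ i • (b i : V) := by
      simpa using e.symm
    rw [e', map_sum, LinearMap.sum_apply]
    exact Finset.sum_eq_zero fun i _ => by simp [this i]
  · funext i
    exact h _ (b i).2

theorem finrank_le_inf_orth_add (D : Form V) (W U : Submodule ℂ V) :
    finrank ℂ U ≤ finrank ℂ (U ⊓ orth D W : Submodule ℂ V) + finrank ℂ W := by
  obtain ⟨g, hg⟩ := exists_pairing D W
  have h := finrank_le_inf_ker_add g U
  have : LinearMap.ker g = orth D W := by
    ext x; simpa using hg x
  rw [this, finrank_fin_fun] at h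
  exact h

/-- Orthogonal projection to a positive definite subspace. -/
theorem IsPosOn.exists_proj {E : Form V} {W : Submodule ℂ V} (hW : IsPosOn E W) (v : V) :
    ∃ w₀ ∈ W, v - w₀ ∈ orth E W := by
  obtain ⟨g, hg⟩ := exists_pairing E W
  -- Definiteness makes the pairing of `W` with itself injective, and the target has dimension dim
  -- W, so it is onto.
  have hinj : LinearMap.ker (g.domRestrict W) = ⊥ := by
    rw [LinearMap.ker_eq_bot']
    rintro ⟨x, hx⟩ h
    have h' := (hg x).1 h x hx
    by_contra h0
    have := hW x hx (by simpa using h0)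
    simp [h'] at this
  have hsurj : Function.Surjective (g.domRestrict W) :=
    (LinearMap.injective_iff_surjective_of_finrank_eq_finrank (by simp)).1
      (LinearMap.ker_eq_bot.1 hinj)
  obtain ⟨w, hw⟩ := hsurj (g v)
  refine ⟨w, w.2, (hg _).1 ?_⟩
  rw [map_sub, sub_eq_zero, ← hw]
  rfl

/-- Adjoining an orthogonal positive vector to a positive definite subspace. -/
theorem IsPosOn.sup_span {E : Form V} (hE : IsHerm E) {W : Submodule ℂ V} (hW : IsPosOn E W)
    {y : V} (hy : y ∈ orth E W) (hpos : 0 < (E y y).re) :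
    IsPosOn E (W ⊔ Submodule.span ℂ {y}) ∧
      finrank ℂ (W ⊔ Submodule.span ℂ {y} : Submodule ℂ V) = finrank ℂ W + 1 := by
  constructor
  · intro x hx hx0
    obtain ⟨u, hu, c, rfl⟩ := mem_sup_span_singleton.1 hx
    rw [re_add_smul_of_orth hE (hy u hu)]
    by_cases hu0 : u = 0
    · have hc : c ≠ 0 := by rintro rfl; simp [hu0] at hx0
      simpa [hu0] using mul_pos (Complex.normSq_pos.2 hc) hpos
    · have := hW u hu hu0
      have := mul_nonneg (Complex.normSq_nonneg c) hpos.le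
      linarith
  · refine Submodule.finrank_sup_span_singleton fun hyW => ?_
    have := hy y hyW
    simp [this] at hpos

theorem lt_posIdx_of_orth {E : Form V} (hE : IsHerm E) {W U : Submodule ℂ V} (hWU : W ≤ U)
    (hW : IsPosOn E W) {y : V} (hyU : y ∈ U) (hy : y ∈ orth E W) (hpos : 0 < (E y y).re) :
    finrank ℂ W + 1 ≤ posIdx E U := by
  obtain ⟨h1, h2⟩ := hW.sup_span hE hy hpos
  rw [← h2]
  exact le_posIdx (sup_le hWU (by simpa using hyU)) h1

/-- A complement on which the form is nonpositive. -/
theorem exists_nonpos_complement {E : Form V} (hE : IsHerm E) (U : Submodule ℂ V) :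
    ∃ N ≤ U, (∀ x ∈ N, (E x x).re ≤ 0) ∧ posIdx E U + finrank ℂ N = finrank ℂ U := by
  obtain ⟨W, hWU, hW, e⟩ := exists_posIdx E U
  have hneg : ∀ x ∈ U ⊓ orth E W, (E x x).re ≤ 0 := by
    intro x hx
    by_contra! h
    have := lt_posIdx_of_orth hE hWU hW hx.1 hx.2 h
    omega
  refine ⟨U ⊓ orth E W, inf_le_left, hneg, le_antisymm
    (posIdx_add_finrank_le_of_nonpos inf_le_left hneg) ?_⟩
  have := finrank_le_inf_orth_add E W U
  omega

/-- A null vector of the radical that is paired nontrivially raises the index. -/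
theorem posIdx_succ_le_of_pairing {E : Form V} (hE : IsHerm E) {U U' : Submodule ℂ V}
    (hU : U ≤ U') {k v : V} (hk : k ∈ rad E U) (hv : v ∈ U') (hkv : E v k ≠ 0) :
    posIdx E U + 1 ≤ posIdx E U' := by
  obtain ⟨W, hWU, hW, e⟩ := exists_posIdx E U
  obtain ⟨w₀, hw₀, ho⟩ := hW.exists_proj v
  have hk0 : ∀ w ∈ U, E w k = 0 := fun w hw => hE.swap_eq_zero (hk.2 w hw)
  set v₁ := v - w₀ with hv₁
  have hkv₁ : E v₁ k = E v k := by simp [hv₁, hk0 w₀ (hWU hw₀)]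
  -- Since k is null, the value at v₁ + s·k is E(v₁,v₁) + 2 Re(s·E(v₁,k)); this `s` normalises it to
  -- 1 whatever the sign of E(v₁,v₁).
  set s : ℂ := (((1 - (E v₁ v₁).re) / 2 : ℝ) : ℂ) / E v k with hs
  have hval : (E (v₁ + s • k) (v₁ + s • k)).re = 1 := by
    rw [hE.re_add, re_smul, hk.2 k hk.1, map_smul, hkv₁, smul_eq_mul, hs,
      div_mul_cancel₀ _ hkv, Complex.ofReal_re]
    simp
    ring
  rw [← e]
  refine lt_posIdx_of_orth hE (hWU.trans hU) hW (y := v₁ + s • k) ?_ ?_ (by rw [hval]; norm_num)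
  · exact U'.add_mem (U'.sub_mem hv (hU (hWU hw₀))) (U'.smul_mem _ (hU hk.1))
  · intro w hw
    rw [map_add, ho w hw, map_smul, hk0 w (hWU hw)]
    simp

/-- A subspace of the radical of `E` on `U` contributes its rank to the index on `V₀`. -/
theorem posIdx_add_finrank_le_of_rad {E : Form V} (hE : IsHerm E) {V₀ : Submodule ℂ V} :
    ∀ (R U : Submodule ℂ V), U ≤ V₀ → R ≤ rad E U →
      posIdx E U + finrank ℂ R ≤ posIdx E V₀ + finrank ℂ (R ⊓ rad E V₀ : Submodule ℂ V) := by
  intro R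
  induction h : finrank ℂ R generalizing R with
  | zero =>
    intro U hU _
    have := posIdx_mono E hU
    omega
  | succ d ih =>
    intro U hU hR
    by_cases hc : R ≤ rad E V₀
    · rw [inf_eq_left.2 hc, h]
      have := posIdx_mono E hU
      omega
    · obtain ⟨k, hkR, hk⟩ := SetLike.not_le_iff_exists.1 hc
      have : ∃ v ∈ V₀, E k v ≠ 0 := by
        by_contra! h0
        exact hk ⟨hU (hR hkR).1, h0⟩
      obtain ⟨v, hv, hkv⟩ := this
      have hvk : E v k ≠ 0 := fun h0 => hkv (hE.swap_eq_zero h0)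
      have hU' : U ⊔ Submodule.span ℂ {v} ≤ V₀ := sup_le hU (by simpa using hv)
      have h1 := posIdx_succ_le_of_pairing hE (le_sup_left (b := Submodule.span ℂ {v}))
        (hR hkR) (Submodule.mem_sup_right (Submodule.mem_span_singleton_self v)) hvk
      have hf := finrank_map_add_finrank_inf_ker (E v) R
      have hf1 : finrank ℂ (R.map (E v)) = 1 := by
        have hle := Submodule.finrank_le (R.map (E v))
        have : R.map (E v) ≠ ⊥ := by
          intro h0
          exact hvk ((Submodule.mem_bot ℂ).1 (h0 ▸ Submodule.mem_map_of_mem hkR))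
        have := Submodule.one_le_finrank_iff.2 this
        simp at hle
        omega
      -- Adjoining v spends one dimension of R and gains one in the index; what remains of R is
      -- still radical on the larger subspace.
      have h2 := ih (R ⊓ LinearMap.ker (E v)) (by omega) _ hU' (by
        intro x hx
        have hx1 := hR hx.1
        refine ⟨Submodule.mem_sup_left hx1.1, fun u hu => ?_⟩
        obtain ⟨u', hu', c, rfl⟩ := mem_sup_span_singleton.1 hu
        rw [map_add, hx1.2 u' hu', map_smul, hE.swap_eq_zero hx.2]
        simp)
      have h3 := Submodule.finrank_mono
        (inf_le_inf_right (rad E V₀) (inf_le_left : R ⊓ LinearMap.ker (E v) ≤ R))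
      omega

/-- Nonnegative subspaces bound the index from below. -/
theorem finrank_le_posIdx_of_nonneg {E : Form V} (hE : IsHerm E) {W V₀ : Submodule ℂ V}
    (hW : W ≤ V₀) (h : ∀ x ∈ W, 0 ≤ (E x x).re) :
    finrank ℂ W ≤ posIdx E V₀ + finrank ℂ (W ⊓ rad E V₀ : Submodule ℂ V) := by
  -- A nonnegative form is definite on a complement of its radical; the radical of `W` is then
  -- counted by `posIdx_add_finrank_le_of_rad`.
  obtain ⟨P, hP⟩ := Submodule.exists_isCompl (rad E W)
  have h1 : IsPosOn E (P ⊓ W) := by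
    intro x hx hx0
    by_contra! hle
    refine hx0 ?_
    have : x ∈ rad E W := ⟨hx.2, fun u hu => hE.eq_zero_of_null h hx.2 hu hle⟩
    exact (Submodule.mem_bot ℂ).1 (hP.disjoint.le_bot ⟨this, hx.1⟩)
  have h2 := le_posIdx (inf_le_right : P ⊓ W ≤ W) h1
  have h3 := posIdx_add_finrank_le_of_rad hE (rad E W) W hW le_rfl
  have h4 : (rad E W) ⊔ (P ⊓ W) = W := by
    rw [← sup_inf_assoc_of_le P (rad_le E W), hP.sup_eq_top, top_inf_eq]
  have h5 := Submodule.finrank_add_le_finrank_add_finrank (rad E W) (P ⊓ W)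
  rw [h4] at h5
  have h6 := Submodule.finrank_mono (inf_le_inf_right (rad E V₀) (rad_le E W))
  omega

/-- One inequality holds because a maximal positive subspace together with the radical is
semidefinite, the other because a nonpositive complement exceeds the negative index only by radical
vectors. -/
theorem posIdx_add_negIdx_add_rad {E : Form V} (hE : IsHerm E) (U : Submodule ℂ V) :
    posIdx E U + posIdx (-E) U + finrank ℂ (rad E U) = finrank ℂ U := by
  apply le_antisymm
  · obtain ⟨W, hWU, hW, e⟩ := exists_posIdx E U
    have hn : ∀ x ∈ W ⊔ rad E U, ((-E) x x).re ≤ 0 := by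
      intro x hx
      obtain ⟨w, hw, r, hr, rfl⟩ := Submodule.mem_sup.1 hx
      have h1 : 0 ≤ (E w w).re := by
        by_cases h0 : w = 0
        · simp [h0]
        · exact (hW w hw h0).le
      have h2 : E w r = 0 := hE.swap_eq_zero (hr.2 w (hWU hw))
      have := hE.re_add w r
      rw [h2, hr.2 r hr.1] at this
      simp only [LinearMap.neg_apply, Complex.neg_re, this]
      simpa using h1
    have h1 := posIdx_add_finrank_le_of_nonpos (sup_le hWU (rad_le E U)) hn
    have h2 := Submodule.finrank_sup_add_finrank_inf_eq W (rad E U)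
    have h3 : W ⊓ rad E U = ⊥ := by
      rw [Submodule.eq_bot_iff]
      intro x hx
      by_contra h0
      have := hW x hx.1 h0
      simp [hx.2.2 x hx.2.1] at this
    rw [h3, finrank_bot] at h2
    omega
  · obtain ⟨N, hNU, hN, e⟩ := exists_nonpos_complement hE U
    have h1 := finrank_le_posIdx_of_nonneg hE.neg hNU (fun x hx => by simpa using hN x hx)
    have h2 : rad (-E) U = rad E U := by
      ext x; simp [mem_rad]
    rw [h2] at h1
    have h3 := Submodule.finrank_mono (inf_le_right : N ⊓ rad E U ≤ _)
    omega

/-- Adjoining an orthogonal nonpositive vector does not raise the index. -/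
theorem posIdx_sup_span_le {E : Form V} (hE : IsHerm E) {U : Submodule ℂ V} {v : V}
    (hv : v ∈ orth E U) (hneg : (E v v).re ≤ 0) :
    posIdx E (U ⊔ Submodule.span ℂ {v}) ≤ posIdx E U := by
  obtain ⟨N, hNU, hN, e⟩ := exists_nonpos_complement hE U
  by_cases hvU : v ∈ U
  · rw [sup_eq_left.2 (by simpa using hvU)]
  have hvN : v ∉ N := fun h => hvU (hNU h)
  have h1 := posIdx_add_finrank_le_of_nonpos (D := E)
    (sup_le_sup_right hNU (Submodule.span ℂ {v})) (by
      intro x hx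
      obtain ⟨u, hu, c, rfl⟩ := mem_sup_span_singleton.1 hx
      rw [re_add_smul_of_orth hE (hv u (hNU hu))]
      have := hN u hu
      have := mul_nonneg (Complex.normSq_nonneg c) (neg_nonneg.2 hneg)
      linarith)
  rw [Submodule.finrank_sup_span_singleton hvU, Submodule.finrank_sup_span_singleton hvN] at h1
  omega

end Forms

end LMI

/-! ### Dominating extensions of a form, and maximal indices -/

namespace LMI

open Module

section Extensions

variable {V : Type*} [AddCommGroup V] [Module ℂ V]

/-- The Hermitian form `M` agrees with `E` on `U` and dominates `D` on `U'`. -/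
structure IsExtension (D E : Form V) (U U' : Submodule ℂ V) (M : Form V) : Prop where
  herm : IsHerm M
  agree : ∀ x ∈ U, ∀ y ∈ U, M x y = E x y
  dom : ∀ x ∈ U', (D x x).re ≤ (M x x).re

theorem IsExtension.trans {D E E' M : Form V} {U U' U'' : Submodule ℂ V} (hU : U ≤ U')
    (h : IsExtension D E U U' E') (h' : IsExtension D E' U' U'' M) : IsExtension D E U U'' M :=
  ⟨h'.herm, fun x hx y hy => (h'.agree x (hU hx) y (hU hy)).trans (h.agree x hx y hy), h'.dom⟩

/-- Prescribing the values of an extension on one further vector. -/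
theorem exists_extension_step {D E : Form V} (hD : IsHerm D) (hE : IsHerm E)
    {U : Submodule ℂ V} (hDE : ∀ x ∈ U, (D x x).re ≤ (E x x).re) {v : V} (hv : v ∉ U)
    {q : ℝ} (hq : 0 ≤ q) :
    ∃ E', IsExtension D E U (U ⊔ Submodule.span ℂ {v}) E' ∧ (∀ u ∈ U, E' v u = D v u) ∧
      (E' v v).re = (D v v).re + q ∧
      ∀ u ∈ U, ∀ c : ℂ, (E' (u + c • v) (u + c • v)).re - (D (u + c • v) (u + c • v)).re
        = (E u u).re - (D u u).re + Complex.normSq c * q := by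
  obtain ⟨f, hf, hfv⟩ := LinearMap.exists_extend_of_notMem (0 : U →ₗ[ℂ] ℂ) hv 1
  have hf0 : ∀ u ∈ U, f u = 0 := fun u hu => by simpa using congr($hf ⟨u, hu⟩)
  let h : V →ₗ[ℂ] ℂ := D v - E v
  -- At (v,v) the two cross terms of `R` contribute 2(D(v,v) - E(v,v)), once too often; `c`
  -- compensates and adds q.
  let c : ℝ := (E v v).re - (D v v).re + q
  let R : Form V := LinearMap.mk₂'ₛₗ (starRingEnd ℂ) (RingHom.id ℂ)
    (fun x y => star (f x) * h y + star (h x) * f y + c * (star (f x) * f y))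
    (by intros; simp only [map_add, star_add]; ring)
    (by intros; simp only [map_smul, smul_eq_mul, star_mul', Complex.star_def]; ring)
    (by intros; simp only [map_add]; ring)
    (by intros; simp only [map_smul, smul_eq_mul, RingHom.id_apply]; ring)
  have hR : ∀ x y, R x y = star (f x) * h y + star (h x) * f y + c * (star (f x) * f y) :=
    fun _ _ => rfl
  have hRh : IsHerm R := fun x y => by
    rw [hR, hR]
    simp only [star_add, star_mul', Complex.star_def, Complex.conj_conj,
      Complex.conj_ofReal]
    ring
  have hag : ∀ x ∈ U, ∀ y ∈ U, (E + R) x y = E x y := fun x hx y hy => by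
    simp [hR, hf0 x hx, hf0 y hy]
  have hvu : ∀ u ∈ U, (E + R) v u = D v u := fun u hu => by
    simp [hR, hf0 u hu, hfv, h]
  have hvv : ((E + R) v v).re = (D v v).re + q := by
    simp [hR, hfv, h, c]
    ring
  have key : ∀ u ∈ U, ∀ c : ℂ, ((E + R) (u + c • v) (u + c • v)).re
      - (D (u + c • v) (u + c • v)).re
        = (E u u).re - (D u u).re + Complex.normSq c * q := by
    intro u hu c
    have h1 : (E + R) u v = D u v := by
      rw [(hE.add hRh) u v, hvu u hu, ← hD u v]
    rw [(hE.add hRh).re_add, hD.re_add, re_smul, re_smul, hvv, map_smul, map_smul, h1,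
      hag u hu u hu]
    ring
  refine ⟨E + R, ⟨hE.add hRh, hag, ?_⟩, hvu, hvv, key⟩
  intro x hx
  obtain ⟨u, hu, c, rfl⟩ := mem_sup_span_singleton.1 hx
  have := key u hu c
  have := hDE u hu
  have := mul_nonneg (Complex.normSq_nonneg c) hq
  linarith

theorem rad_congr {E E' : Form V} {U : Submodule ℂ V}
    (h : ∀ x ∈ U, ∀ y ∈ U, E' x y = E x y) : rad E' U = rad E U := by
  ext x
  constructor <;> rintro ⟨hx, hx'⟩ <;> refine ⟨hx, fun u hu => ?_⟩
  · rw [← h x hx u hu, hx' u hu]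
  · rw [h x hx u hu, hx' u hu]

theorem rad_inf_le (E : Form V) {U U' : Submodule ℂ V} (h : U ≤ U') :
    rad E U' ⊓ U ≤ rad E U := fun _ hx => ⟨hx.2, fun u hu => hx.1.2 u (h hu)⟩

theorem rad_inf_rad_le_of_extension {D E E' : Form V} (hD : IsHerm D) {U U' : Submodule ℂ V} (hU : U ≤ U')
    (h : IsExtension D E U U' E') : rad E U ⊓ rad D ⊤ ≤ rad E' U' ⊓ rad D ⊤ := by
  intro x hx
  refine ⟨⟨hU hx.1.1, fun u hu => ?_⟩, hx.2⟩
  rw [form_ext_re hD h.herm h.dom (hU hx.1.1) hu, hx.2.2 u trivial]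
  rw [h.agree x hx.1.1 x hx.1.1, hx.1.2 x hx.1.1, hx.2.2 x trivial]

theorem exists_notMem_of_finrank {U : Submodule ℂ V} {a : ℕ}
    (ha : finrank ℂ U + (a + 1) = finrank ℂ V) : ∃ v, v ∉ U := by
  by_contra! h
  rw [(Submodule.eq_top_iff').2 h, finrank_top] at ha
  omega

theorem exists_notMem_notMem {U : Submodule ℂ V} {f : V →ₗ[ℂ] ℂ} {v w : V} (hv : v ∉ U)
    (hw : f w ≠ 0) : ∃ x, x ∉ U ∧ f x ≠ 0 := by
  by_cases h1 : f v = 0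
  · by_cases h2 : w ∈ U
    · exact ⟨v + w, fun h => hv (by simpa using U.sub_mem h h2), by simpa [h1] using hw⟩
    · exact ⟨w, h2, hw⟩
  · exact ⟨v, hv, h1⟩

/-- A negative vector stays negative under a small perturbation. -/
theorem IsHerm.exists_perturb {D : Form V} (hD : IsHerm D) {x : V} (hx : (D x x).re < 0)
    (z : V) : ∃ t : ℂ, t ≠ 0 ∧ (D (x + t • z) (x + t • z)).re < 0 := by
  set α := (D x x).re
  set β := 2 * |(D x z).re| + |(D z z).re| + 1 with hβ
  have hβ0 : 0 < β := by positivity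
  -- From t ≤ 1 follows t² ≤ t, so the perturbation changes the value by at most tβ ≤ -α/2.
  set t : ℝ := min 1 (-α / (2 * β)) with ht
  have ht0 : 0 < t := lt_min one_pos (div_pos (neg_pos.2 hx) (by positivity))
  have ht1 : t ≤ 1 := min_le_left _ _
  have ht2 : t * (2 * β) ≤ -α := by
    have : t ≤ -α / (2 * β) := min_le_right _ _
    rwa [le_div_iff₀ (by positivity)] at this
  refine ⟨(t : ℂ), by exact_mod_cast ht0.ne', ?_⟩
  rw [hD.re_add, re_smul, map_smul, Complex.normSq_ofReal, smul_eq_mul, Complex.re_ofReal_mul]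
  have h1 := mul_le_mul_of_nonneg_left (le_abs_self (D x z).re) ht0.le
  have h2 : t * t * (D z z).re ≤ t * |(D z z).re| :=
    (mul_le_mul_of_nonneg_left (le_abs_self _) (by positivity)).trans
      (mul_le_mul_of_nonneg_right (by nlinarith) (abs_nonneg _))
  nlinarith

variable [FiniteDimensional ℂ V]

theorem posIdx_congr {E E' : Form V} {U : Submodule ℂ V}
    (h : ∀ x ∈ U, ∀ y ∈ U, E' x y = E x y) : posIdx E' U = posIdx E U :=
  le_antisymm (posIdx_mono_form fun x hx => by rw [h x hx x hx])
    (posIdx_mono_form fun x hx => by rw [h x hx x hx])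

theorem posIdx_neg_congr {E E' : Form V} {U : Submodule ℂ V}
    (h : ∀ x ∈ U, ∀ y ∈ U, E' x y = E x y) : posIdx (-E') U = posIdx (-E) U :=
  posIdx_congr fun x hx y hy => by simp [h x hx y hy]

theorem posIdx_sup_span_le_succ (E : Form V) {U : Submodule ℂ V} {v : V} (hv : v ∉ U) :
    posIdx E (U ⊔ Submodule.span ℂ {v}) ≤ posIdx E U + 1 := by
  have := posIdx_add_finrank_le (D := E) (le_sup_left (a := U) (b := Submodule.span ℂ {v}))
  rw [Submodule.finrank_sup_span_singleton hv] at this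
  omega

theorem finrank_le_inf_add_one {U X : Submodule ℂ V} {v : V} (hv : v ∉ U)
    (hX : X ≤ U ⊔ Submodule.span ℂ {v}) :
    finrank ℂ X ≤ finrank ℂ (X ⊓ U : Submodule ℂ V) + 1 := by
  have h1 := Submodule.finrank_sup_add_finrank_inf_eq X U
  have h2 := Submodule.finrank_mono (sup_le hX le_sup_left)
  rw [Submodule.finrank_sup_span_singleton hv] at h2
  omega

theorem finrank_inf_ker_lt {f : V →ₗ[ℂ] ℂ} {X : Submodule ℂ V} {k : V} (hk : k ∈ X)
    (hf : f k ≠ 0) : finrank ℂ (X ⊓ LinearMap.ker f : Submodule ℂ V) + 1 ≤ finrank ℂ X := by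
  have : X ⊓ LinearMap.ker f < X := by
    refine lt_of_le_of_ne inf_le_left fun h => hf ?_
    have : k ∈ X ⊓ LinearMap.ker f := h.symm ▸ hk
    exact this.2
  exact Submodule.finrank_lt_finrank_of_lt this

theorem finrank_le_inf_ker_add_one (f : V →ₗ[ℂ] ℂ) (X : Submodule ℂ V) :
    finrank ℂ X ≤ finrank ℂ (X ⊓ LinearMap.ker f : Submodule ℂ V) + 1 := by
  simpa using finrank_le_inf_ker_add f X

variable {D : Form V} (hD : IsHerm D)
include hD

/-- Maximising the negative index. -/
theorem exists_extension_negIdx_ge (t : ℕ) (ht : t ≤ posIdx (-D) ⊤) :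
    ∀ (a : ℕ) (U : Submodule ℂ V) (E : Form V), finrank ℂ U + a = finrank ℂ V → IsHerm E →
      (∀ x ∈ U, (D x x).re ≤ (E x x).re) → t ≤ a + posIdx (-E) U →
      ∃ M, IsExtension D E U ⊤ M ∧ t ≤ posIdx (-M) ⊤ := by
  intro a
  induction a with
  | zero =>
    intro U E hU hE hDE hle
    have hU' : U = ⊤ := Submodule.eq_top_of_finrank_eq hU
    subst hU'
    exact ⟨E, ⟨hE, fun _ _ _ _ => rfl, hDE⟩, by simpa using hle⟩
  | succ a ih =>
    intro U E hU hE hDE hle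
    obtain ⟨v, hv⟩ := exists_notMem_of_finrank hU
    suffices ∃ x, x ∉ U ∧ ∃ E', IsExtension D E U (U ⊔ Submodule.span ℂ {x}) E' ∧
        t ≤ a + posIdx (-E') (U ⊔ Submodule.span ℂ {x}) by
      obtain ⟨x, hx, E', h1, h2⟩ := this
      obtain ⟨M, h3, h4⟩ := ih _ E' (by rw [Submodule.finrank_sup_span_singleton hx]; omega)
        h1.herm h1.dom h2
      exact ⟨M, h1.trans le_sup_left h3, h4⟩
    -- If the index on U has already reached t, any step keeps it. Otherwise this step must raise
    -- it: a maximal negative subspace P for E is negative for D too and has dimension below t,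
    -- which leaves a D-negative vector orthogonal to P.
    by_cases hlt : t ≤ posIdx (-E) U
    · obtain ⟨E', h1, -⟩ := exists_extension_step hD hE hDE hv le_rfl
      refine ⟨v, hv, E', h1, ?_⟩
      have := posIdx_mono (-E') (le_sup_left (a := U) (b := Submodule.span ℂ {v}))
      rw [posIdx_neg_congr h1.agree] at this
      omega
    · obtain ⟨P, hPU, hP, e⟩ := exists_posIdx (-E) U
      obtain ⟨W, -, hW, e'⟩ := exists_posIdx (-D) ⊤
      have hPD : IsPosOn (-D) P := fun x hx h0 => (hP x hx h0).trans_le (by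
        simpa using hDE x (hPU hx))
      have : ∃ x ∈ orth (-D) P, (D x x).re < 0 := by
        have h1 := finrank_le_inf_orth_add (-D) P W
        have h2 : W ⊓ orth (-D) P ≠ ⊥ := by
          intro h0
          rw [h0, finrank_bot] at h1
          omega
        obtain ⟨x, hx, hx0⟩ := Submodule.exists_mem_ne_zero_of_ne_bot h2
        exact ⟨x, hx.2, by simpa using hW x hx.1 hx0⟩
      obtain ⟨x, hxP, hx⟩ := this
      have : ∃ x, x ∉ U ∧ x ∈ orth (-D) P ∧ (D x x).re < 0 := by
        by_cases hxU : x ∈ U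
        · obtain ⟨p, hp, hz⟩ := hPD.exists_proj v
          obtain ⟨s, hs, hneg⟩ := hD.exists_perturb hx (v - p)
          refine ⟨_, fun h => hv ?_, Submodule.add_mem _ hxP (Submodule.smul_mem _ s hz), hneg⟩
          have h1 : s • (v - p) ∈ U := by simpa using U.sub_mem h hxU
          have h2 := (U.smul_mem_iff hs).1 h1
          simpa using U.add_mem h2 (hPU hp)
        · exact ⟨x, hxU, hxP, hx⟩
      obtain ⟨x, hxU, hxP, hx⟩ := this
      obtain ⟨E', h1, h2, h3, -⟩ := exists_extension_step hD hE hDE hxU le_rfl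
      refine ⟨x, hxU, E', h1, ?_⟩
      have h4 : finrank ℂ P + 1 ≤ posIdx (-E') (U ⊔ Submodule.span ℂ {x}) := by
        refine lt_posIdx_of_orth h1.herm.neg (hPU.trans le_sup_left) (fun y hy h0 => ?_)
          (y := x) (Submodule.mem_sup_right (Submodule.mem_span_singleton_self x))
          (fun w hw => ?_) ?_
        · simpa [h1.agree y (hPU hy) y (hPU hy)] using hP y hy h0
        · have : D x w = 0 := hD.swap_eq_zero (by simpa using hxP w hw)
          rw [LinearMap.neg_apply, LinearMap.neg_apply,
            h1.herm.swap_eq_zero (x := x) (y := w) (by rw [h2 w (hPU hw), this]), neg_zero]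
        · simpa [h3] using hx
      omega

/-- Maximising the positive index and the rank. -/
theorem exists_extension_posIdx_ge :
    ∀ (a t : ℕ) (U : Submodule ℂ V) (E : Form V), finrank ℂ U + a = finrank ℂ V → IsHerm E →
      (∀ x ∈ U, (D x x).re ≤ (E x x).re) → t ≤ a →
      finrank ℂ (rad E U ⊓ rad D ⊤ : Submodule ℂ V) + t ≤ finrank ℂ (rad E U) →
      ∃ M, IsExtension D E U ⊤ M ∧ a + posIdx E U ≤ posIdx M ⊤ ∧
        t + posIdx (-E) U ≤ posIdx (-M) ⊤ := by
  intro a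
  induction a with
  | zero =>
    intro t U E hU hE hDE hta _
    have hU' : U = ⊤ := Submodule.eq_top_of_finrank_eq hU
    subst hU'
    exact ⟨E, ⟨hE, fun _ _ _ _ => rfl, hDE⟩, by simp, by simp [Nat.le_zero.1 hta]⟩
  | succ a ih =>
    intro t U E hU hE hDE hta ht
    obtain ⟨v, hv⟩ := exists_notMem_of_finrank hU
    -- `t` counts the remaining steps that must raise both indices. Once it is used up, a large gap
    -- on v raises the positive index alone.
    rcases t with _ | t
    · obtain ⟨W, hWU, hW, e⟩ := exists_posIdx E U
      -- The values E'(v,u) for u in U do not depend on q. So w can be found from the extension with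
      -- q = 0, and q chosen afterwards, large enough to make v - w positive.
      obtain ⟨E₀, h1₀, h2₀, h3₀, -⟩ := exists_extension_step hD hE hDE hv le_rfl
      have hW₀ : IsPosOn E₀ W := fun x hx h0 => by
        simpa [h1₀.agree x (hWU hx) x (hWU hx)] using hW x hx h0
      obtain ⟨w, hw, ho⟩ := hW₀.exists_proj v
      obtain ⟨E', h1, h2, h3, h4⟩ := exists_extension_step hD hE hDE hv
        (q := |(D (v - w) (v - w)).re| + 1) (by positivity)
      have h5 : a + 0 + (posIdx E U + 1) ≤ a + posIdx E' (U ⊔ Submodule.span ℂ {v}) := by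
        rw [← e, add_zero, add_le_add_iff_left]
        refine lt_posIdx_of_orth h1.herm (hWU.trans le_sup_left) (fun y hy h0 => ?_)
          (y := v - w) (Submodule.sub_mem _
            (Submodule.mem_sup_right (Submodule.mem_span_singleton_self v))
            (Submodule.mem_sup_left (hWU hw)))
          (fun y hy => ?_) ?_
        · simpa [h1.agree y (hWU hy) y (hWU hy)] using hW y hy h0
        · have hy' := ho y hy
          rw [map_sub, h1₀.herm y v, h2₀ y (hWU hy), h1₀.agree y (hWU hy) w (hWU hw)] at hy'
          rw [map_sub, h1.herm y v, h2 y (hWU hy), h1.agree y (hWU hy) w (hWU hw)]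
          exact hy'
        · have := h4 (-w) (U.neg_mem (hWU hw)) 1
          rw [one_smul, neg_add_eq_sub] at this
          have h6 := hDE (-w) (U.neg_mem (hWU hw))
          have h7 := neg_abs_le (D (v - w) (v - w)).re
          simp only [map_one, one_mul] at this
          linarith
      obtain ⟨M, h6, h7, h8⟩ := ih 0 _ E'
        (by rw [Submodule.finrank_sup_span_singleton hv]; omega)
        h1.herm h1.dom (Nat.zero_le _) (Submodule.finrank_mono inf_le_left)
      refine ⟨M, h1.trans le_sup_left h6, by omega, ?_⟩
      have := posIdx_mono (-E') (le_sup_left (a := U) (b := Submodule.span ℂ {v}))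
      rw [posIdx_neg_congr h1.agree] at this
      omega
    · have : ∃ k ∈ rad E U, k ∉ rad D ⊤ := by
        by_contra! h
        rw [inf_eq_left.2 h] at ht
        omega
      obtain ⟨k, hk, hkD⟩ := this
      have : ∃ w, D k w ≠ 0 := by
        by_contra! h
        exact hkD ⟨trivial, fun u _ => h u⟩
      obtain ⟨w, hw⟩ := this
      obtain ⟨v, hv, hkv⟩ := exists_notMem_notMem (f := D k) hv hw
      have hvk : D v k ≠ 0 := fun h => hkv (hD.swap_eq_zero h)
      obtain ⟨E', h1, h2, h3, -⟩ := exists_extension_step hD hE hDE hv le_rfl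
      -- The null vector k now pairs with v, and such a hyperbolic pair raises both indices.
      have hvk' : E' v k ≠ 0 := by rwa [h2 k hk.1]
      have hvmem : v ∈ U ⊔ Submodule.span ℂ {v} :=
        Submodule.mem_sup_right (Submodule.mem_span_singleton_self v)
      have hk' : k ∈ rad E' U := by rwa [rad_congr h1.agree]
      have h5 := posIdx_succ_le_of_pairing h1.herm
        (le_sup_left (a := U) (b := Submodule.span ℂ {v})) hk' hvmem hvk'
      have h6 := posIdx_succ_le_of_pairing h1.herm.neg
        (le_sup_left (a := U) (b := Submodule.span ℂ {v})) (k := k) (v := v)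
        ⟨hk'.1, fun u hu => by simp [hk'.2 u hu]⟩ hvmem (by simpa using hvk')
      rw [posIdx_congr h1.agree] at h5
      rw [posIdx_neg_congr h1.agree] at h6
      have hsub : rad E' (U ⊔ Submodule.span ℂ {v}) ≤ U := by
        intro x hx
        obtain ⟨u, hu, c, rfl⟩ := mem_sup_span_singleton.1 hx.1
        have := hx.2 k (Submodule.mem_sup_left hk.1)
        rw [map_add, LinearMap.add_apply, map_smulₛₗ, LinearMap.smul_apply,
          h1.herm.swap_eq_zero (hk'.2 u hu), zero_add, smul_eq_mul] at this
        have hc : c = 0 := by simpa [hvk'] using this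
        simpa [hc] using hu
      have h7 : rad E U ⊓ LinearMap.ker (E' v) ≤ rad E' (U ⊔ Submodule.span ℂ {v}) := by
        intro x hx
        refine ⟨Submodule.mem_sup_left hx.1.1, fun y hy => ?_⟩
        obtain ⟨u, hu, c, rfl⟩ := mem_sup_span_singleton.1 hy
        rw [map_add, map_smul, h1.agree x hx.1.1 u hu, hx.1.2 u hu,
          h1.herm.swap_eq_zero (x := v) (y := x) hx.2]
        simp
      have h8 := Submodule.finrank_mono h7
      have h9 := finrank_le_inf_ker_add_one (E' v) (rad E U)
      have h10 : rad E' (U ⊔ Submodule.span ℂ {v}) ⊓ rad D ⊤ ≤ rad E U ⊓ rad D ⊤ := by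
        intro x hx
        refine ⟨?_, hx.2⟩
        rw [← rad_congr h1.agree]
        exact rad_inf_le E' le_sup_left ⟨hx.1, hsub hx.1⟩
      have h11 := Submodule.finrank_mono h10
      obtain ⟨M, h12, h13, h14⟩ := ih t _ E'
        (by rw [Submodule.finrank_sup_span_singleton hv]; omega)
        h1.herm h1.dom (by omega) (by omega)
      exact ⟨M, h1.trans le_sup_left h12, by omega, by omega⟩

end Extensions

end LMI

/-! ### Simultaneous minimisation of both indices -/

namespace LMI

open Module

section MinimalExtension

variable {V : Type*} [AddCommGroup V] [Module ℂ V]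

/-- The difference of `D` and `E` as a form on the product space. -/
noncomputable def prodForm (D E : Form V) : Form (V × V) :=
  LinearMap.mk₂'ₛₗ (starRingEnd ℂ) (RingHom.id ℂ)
    (fun x y => D x.1 y.1 - E x.2 y.2)
    (by intros; simp only [Prod.fst_add, Prod.snd_add, map_add, LinearMap.add_apply]; ring)
    (by
      intros
      simp only [Prod.smul_fst, Prod.smul_snd, map_smulₛₗ, LinearMap.smul_apply, smul_eq_mul]
      ring)
    (by intros; simp only [Prod.fst_add, Prod.snd_add, map_add]; ring)
    (by
      intros
      simp only [Prod.smul_fst, Prod.smul_snd, map_smul, smul_eq_mul, RingHom.id_apply]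
      ring)

theorem prodForm_apply (D E : Form V) (x y : V × V) :
    prodForm D E x y = D x.1 y.1 - E x.2 y.2 := rfl

theorem IsHerm.prodForm {D E : Form V} (hD : IsHerm D) (hE : IsHerm E) :
    IsHerm (prodForm D E) := fun x y => by
  simp only [prodForm_apply, star_sub]
  rw [hD x.1, hE x.2]

/-- Pairs `(x, y)` with `y ∈ U` such that `D x` and `E y` agree on `U`. -/
noncomputable def matching (D E : Form V) (U : Submodule ℂ V) : Submodule ℂ (V × V) :=
  (⊤ : Submodule ℂ V).prod U ⊓
    orth (prodForm D E) (U.map (LinearMap.prod LinearMap.id LinearMap.id))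

theorem mem_matching {D E : Form V} {U : Submodule ℂ V} {x : V × V} :
    x ∈ matching D E U ↔ x.2 ∈ U ∧ ∀ u ∈ U, D u x.1 = E u x.2 := by
  constructor
  · rintro ⟨⟨-, h1⟩, h2⟩
    refine ⟨h1, fun u hu => ?_⟩
    have := h2 _ (Submodule.mem_map_of_mem hu)
    simpa [prodForm_apply, sub_eq_zero] using this
  · rintro ⟨h1, h2⟩
    refine ⟨⟨trivial, h1⟩, ?_⟩
    rintro _ ⟨u, hu, rfl⟩
    simpa [prodForm_apply, sub_eq_zero] using h2 u hu

theorem finrank_map_of_injective {W : Type*} [AddCommGroup W] [Module ℂ W] {f : V →ₗ[ℂ] W}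
    (hf : Function.Injective f) (U : Submodule ℂ V) : finrank ℂ (U.map f) = finrank ℂ U :=
  (Submodule.equivMapOfInjective f hf U).finrank_eq.symm

variable [FiniteDimensional ℂ V]

theorem finrank_prod_submodule (A B : Submodule ℂ V) :
    finrank ℂ (A.prod B) = finrank ℂ A + finrank ℂ B := by
  have h := finrank_map_add_finrank_inf_ker (LinearMap.fst ℂ V V) (A.prod B)
  have h1 : (A.prod B).map (LinearMap.fst ℂ V V) = A := by
    ext x
    constructor
    · rintro ⟨y, hy, rfl⟩; exact hy.1
    · intro hx; exact ⟨(x, 0), ⟨hx, B.zero_mem⟩, rfl⟩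
  have h2 : A.prod B ⊓ LinearMap.ker (LinearMap.fst ℂ V V) = B.map (LinearMap.inr ℂ V V) := by
    ext ⟨x, y⟩
    constructor
    · rintro ⟨⟨_, hy⟩, h0⟩
      have h0 : x = 0 := h0
      exact ⟨y, hy, by simp [h0]⟩
    · rintro ⟨z, hz, he⟩
      simp only [LinearMap.inr_apply, Prod.mk.injEq] at he
      obtain ⟨rfl, rfl⟩ := he
      exact ⟨⟨A.zero_mem, hz⟩, rfl⟩
  rw [h1, h2, finrank_map_of_injective] at h
  · exact h.symm
  · exact LinearMap.inr_injective

/-- Row rank equals column rank for the pairing of two subspaces. -/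
theorem finrank_add_inf_orth_le {D : Form V} (hD : IsHerm D) (K U : Submodule ℂ V) :
    finrank ℂ K + finrank ℂ (U ⊓ orth D K : Submodule ℂ V)
      ≤ finrank ℂ (K ⊓ orth D U : Submodule ℂ V) + finrank ℂ U := by
  obtain ⟨P, hP⟩ := Submodule.exists_isCompl (U ⊓ orth D K)
  have hsup : (U ⊓ orth D K) ⊔ (P ⊓ U) = U := by
    rw [← sup_inf_assoc_of_le P inf_le_left, hP.sup_eq_top, top_inf_eq]
  have h1 := finrank_le_inf_orth_add D (P ⊓ U) K
  have h2 : K ⊓ orth D (P ⊓ U) ≤ K ⊓ orth D U := by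
    refine fun x hx => ⟨hx.1, fun u hu => ?_⟩
    rw [← hsup] at hu
    obtain ⟨y, hy, z, hz, rfl⟩ := Submodule.mem_sup.1 hu
    rw [map_add, LinearMap.add_apply, hx.2 z hz, hD.swap_eq_zero (hy.2 x hx.1), add_zero]
  have h3 := Submodule.finrank_mono h2
  have h4 := Submodule.finrank_sup_add_finrank_inf_eq (U ⊓ orth D K) (P ⊓ U)
  have h5 : (U ⊓ orth D K) ⊓ (P ⊓ U) = ⊥ := by
    rw [← le_bot_iff]
    exact (inf_le_inf_left _ inf_le_left).trans hP.disjoint.le_bot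
  rw [hsup, h5, finrank_bot] at h4
  omega

variable {D E : Form V} (hD : IsHerm D) (hE : IsHerm E) {U : Submodule ℂ V}

include hD hE

/-- `matching` is the orthogonal complement in V × U of the diagonal copy of U. Diagonal vectors
over rad E|U ∩ rad D are orthogonal to all of V × U and impose no condition. -/
theorem finrank_matching_ge : finrank ℂ V + finrank ℂ (rad E U ⊓ rad D ⊤ : Submodule ℂ V)
    ≤ finrank ℂ (matching D E U) := by
  set Δ := U.map (LinearMap.prod LinearMap.id LinearMap.id : V →ₗ[ℂ] V × V) with hΔ
  have hinj : Function.Injective (LinearMap.prod LinearMap.id LinearMap.id : V →ₗ[ℂ] V × V) :=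
    fun x y h => congrArg Prod.fst h
  have h1 := finrank_add_inf_orth_le (hD.prodForm hE) ((⊤ : Submodule ℂ V).prod U) Δ
  have h2 : (rad E U ⊓ rad D ⊤).map (LinearMap.prod LinearMap.id LinearMap.id : V →ₗ[ℂ] V × V)
      ≤ Δ ⊓ orth (prodForm D E) ((⊤ : Submodule ℂ V).prod U) := by
    rintro _ ⟨x, hx, rfl⟩
    refine ⟨Submodule.mem_map_of_mem hx.1.1, fun w hw => ?_⟩
    have e1 : D w.1 x = 0 := hD.swap_eq_zero (hx.2.2 _ trivial)
    have e2 : E w.2 x = 0 := hE.swap_eq_zero (hx.1.2 _ hw.2)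
    simp [prodForm_apply, e1, e2]
  have h3 := Submodule.finrank_mono h2
  rw [finrank_map_of_injective hinj] at h3
  rw [finrank_prod_submodule, finrank_top, hΔ, finrank_map_of_injective hinj,
    ← hΔ] at h1
  have : finrank ℂ (matching D E U) = finrank ℂ ((⊤ : Submodule ℂ V).prod U ⊓
    orth (prodForm D E) Δ : Submodule ℂ (V × V)) := rfl
  omega

/-- Otherwise the first components lie in U and are D-orthogonal to rad E|U, with fibres inside rad
E|U. Equality of row and column rank then bounds the dimension of `matching` by dim U + u₀, below
its actual size. -/
theorem exists_matching_notMem (hlt : finrank ℂ U < finrank ℂ V)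
    (hK : rad E U ⊓ rad D U ≤ rad D ⊤) : ∃ x ∈ matching D E U, x.1 ∉ U := by
  by_contra! h
  have h1 := finrank_matching_ge hD hE (U := U)
  have h2 := finrank_map_add_finrank_inf_ker (LinearMap.fst ℂ V V) (matching D E U)
  have h3 : (matching D E U).map (LinearMap.fst ℂ V V) ≤ U ⊓ orth D (rad E U) := by
    rintro _ ⟨x, hx, rfl⟩
    refine ⟨h x hx, fun k hk => ?_⟩
    have := (mem_matching.1 hx).2 k hk.1
    rw [LinearMap.fst_apply, this, hk.2 _ (mem_matching.1 hx).1]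
  have h4 : matching D E U ⊓ LinearMap.ker (LinearMap.fst ℂ V V)
      ≤ (rad E U).map (LinearMap.inr ℂ V V) := by
    rintro ⟨x, y⟩ ⟨hx, h0⟩
    have h0 : x = 0 := h0
    obtain ⟨hx1, hx2⟩ := mem_matching.1 hx
    refine ⟨y, ⟨hx1, fun u hu => hE.swap_eq_zero ?_⟩, by simp [h0]⟩
    have := hx2 u hu
    simpa [h0] using this.symm
  have h5 := Submodule.finrank_mono h3
  have h6 := Submodule.finrank_mono h4
  rw [finrank_map_of_injective LinearMap.inr_injective] at h6
  have h7 := finrank_add_inf_orth_le hD (rad E U) U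
  have h8 : rad E U ⊓ orth D U ≤ rad E U ⊓ rad D ⊤ := fun x hx =>
    ⟨hx.1, hK ⟨hx.1, hx.1.1, fun u hu => hD.swap_eq_zero (hx.2 u hu)⟩⟩
  have h9 := Submodule.finrank_mono h8
  omega

/-- If the form were nonnegative on `matching`, the size of that space would be bounded by the index
of `prodForm`, at most that of D plus that of -E on U, plus the two radicals. The hypothesis `hidx`
then forces dim V ≤ dim U. -/
theorem exists_matching_neg (hlt : finrank ℂ U < finrank ℂ V)
    (hK : rad E U ⊓ rad D U ≤ rad D ⊤)
    (hidx : posIdx D ⊤ + finrank ℂ (rad D ⊤)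
      ≤ posIdx E U + finrank ℂ (rad E U ⊓ rad D ⊤ : Submodule ℂ V)) :
    ∃ x ∈ matching D E U, x.1 ∉ U ∧ (prodForm D E x x).re < 0 := by
  have hΦ := hD.prodForm hE
  have : ∃ x ∈ matching D E U, (prodForm D E x x).re < 0 := by
    by_contra! h
    have h1 := finrank_matching_ge hD hE (U := U)
    have h2 := finrank_le_posIdx_of_nonneg hΦ
      (inf_le_left : matching D E U ≤ (⊤ : Submodule ℂ V).prod U) h
    have h3 : matching D E U ⊓ rad (prodForm D E) ((⊤ : Submodule ℂ V).prod U)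
        ≤ (rad D ⊤).prod (rad E U) := by
      rintro x ⟨hx, hx'⟩
      refine ⟨⟨trivial, fun u _ => ?_⟩, ⟨hx.1.2, fun u hu => ?_⟩⟩
      · simpa [prodForm_apply] using hx'.2 (u, 0) ⟨trivial, U.zero_mem⟩
      · simpa [prodForm_apply] using hx'.2 (0, u) ⟨trivial, hu⟩
    have h4 := Submodule.finrank_mono h3
    change _ ≤ finrank ℂ (matching D E U) at h1
    change finrank ℂ (matching D E U) ≤ _ + finrank ℂ (matching D E U ⊓
      rad (prodForm D E) ((⊤ : Submodule ℂ V).prod U) : Submodule ℂ (V × V)) at h2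
    obtain ⟨N, -, hN, e⟩ := exists_nonpos_complement hD ⊤
    obtain ⟨N', hNU', hN', e'⟩ := exists_nonpos_complement hE.neg U
    have h5 := posIdx_add_finrank_le_of_nonpos (D := prodForm D E) (N := N.prod N')
      (U := (⊤ : Submodule ℂ V).prod U) (fun x hx => ⟨trivial, hNU' hx.2⟩) (fun x hx => by
        have h6 := hN x.1 hx.1
        have h7 := hN' x.2 hx.2
        simp only [prodForm_apply, LinearMap.neg_apply, Complex.sub_re, Complex.neg_re] at h7 ⊢
        linarith)
    rw [finrank_prod_submodule] at h4
    rw [finrank_prod_submodule, finrank_prod_submodule, finrank_top] at h5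
    rw [finrank_top] at e
    have h8 := posIdx_add_negIdx_add_rad hE U
    omega
  obtain ⟨x, hx, hneg⟩ := this
  by_cases hxU : x.1 ∈ U
  · obtain ⟨z, hz, hzU⟩ := exists_matching_notMem hD hE hlt hK
    obtain ⟨t, ht, htneg⟩ := hΦ.exists_perturb hneg z
    refine ⟨_, Submodule.add_mem _ hx (Submodule.smul_mem _ t hz), fun h => hzU ?_, htneg⟩
    have h1 : t • z.1 ∈ U := by simpa using U.sub_mem h hxU
    exact (U.smul_mem_iff ht).1 h1
  · exact ⟨x, hx, hxU, hneg⟩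

omit hE

/-- Minimising both indices simultaneously. -/
theorem exists_extension_idx_le (p n : ℕ) :
    ∀ (a : ℕ) (U : Submodule ℂ V) (E : Form V), finrank ℂ U + a = finrank ℂ V → IsHerm E →
      (∀ x ∈ U, (D x x).re ≤ (E x x).re) →
      posIdx E U + finrank ℂ (rad E U ⊓ rad D U : Submodule ℂ V)
        ≤ p + finrank ℂ (rad E U ⊓ rad D ⊤ : Submodule ℂ V) →
      posIdx D ⊤ + finrank ℂ (U ⊓ rad D ⊤ : Submodule ℂ V)
        ≤ p + finrank ℂ (rad E U ⊓ rad D ⊤ : Submodule ℂ V) →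
      posIdx (-E) U + finrank ℂ (rad E U ⊓ rad D U : Submodule ℂ V)
        ≤ n + finrank ℂ (rad E U ⊓ rad D ⊤ : Submodule ℂ V) →
      ∃ M, IsExtension D E U ⊤ M ∧ posIdx M ⊤ ≤ p ∧ posIdx (-M) ⊤ ≤ n := by
  intro a
  induction a with
  | zero =>
    intro U E hU hE hDE h1 _ h3
    have hU' : U = ⊤ := Submodule.eq_top_of_finrank_eq hU
    subst hU'
    exact ⟨E, ⟨hE, fun _ _ _ _ => rfl, hDE⟩, by omega, by omega⟩
  | succ a ih =>
    intro U E hU hE hDE hp1 hp2 hn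
    -- The three inequalities are potentials, preserved by a well-chosen step. At U = ⊤ the radical
    -- terms cancel and leave the bounds p and n.
    suffices ∃ v, v ∉ U ∧ ∃ E', IsExtension D E U (U ⊔ Submodule.span ℂ {v}) E' ∧
        posIdx E' (U ⊔ Submodule.span ℂ {v})
          + finrank ℂ (rad E' (U ⊔ Submodule.span ℂ {v}) ⊓
              rad D (U ⊔ Submodule.span ℂ {v}) : Submodule ℂ V)
          ≤ p + finrank ℂ (rad E' (U ⊔ Submodule.span ℂ {v}) ⊓ rad D ⊤ : Submodule ℂ V) ∧
        posIdx D ⊤ + finrank ℂ ((U ⊔ Submodule.span ℂ {v}) ⊓ rad D ⊤ : Submodule ℂ V)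
          ≤ p + finrank ℂ (rad E' (U ⊔ Submodule.span ℂ {v}) ⊓ rad D ⊤ : Submodule ℂ V) ∧
        posIdx (-E') (U ⊔ Submodule.span ℂ {v})
          + finrank ℂ (rad E' (U ⊔ Submodule.span ℂ {v}) ⊓
              rad D (U ⊔ Submodule.span ℂ {v}) : Submodule ℂ V)
          ≤ n + finrank ℂ (rad E' (U ⊔ Submodule.span ℂ {v}) ⊓ rad D ⊤ : Submodule ℂ V) by
      obtain ⟨v, hv, E', h1, h2, h3, h4⟩ := this
      obtain ⟨M, h5, h6⟩ := ih _ E' (by rw [Submodule.finrank_sup_span_singleton hv]; omega)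
        h1.herm h1.dom h2 h3 h4
      exact ⟨M, h1.trans le_sup_left h5, h6⟩
    have hu2 : ∀ (v : V) (E' : Form V), IsExtension D E U (U ⊔ Submodule.span ℂ {v}) E' →
        (rad E' (U ⊔ Submodule.span ℂ {v}) ⊓ rad D (U ⊔ Submodule.span ℂ {v})) ⊓ U
          ≤ rad E U ⊓ rad D U := by
      intro v E' h x hx
      rw [← rad_congr h.agree]
      exact ⟨rad_inf_le E' le_sup_left ⟨hx.1.1, hx.2⟩, rad_inf_le D le_sup_left ⟨hx.1.2, hx.2⟩⟩
    by_cases hDU : rad D ⊤ ≤ U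
    · have hu1 : ∀ v : V, finrank ℂ ((U ⊔ Submodule.span ℂ {v}) ⊓ rad D ⊤ : Submodule ℂ V)
          = finrank ℂ (U ⊓ rad D ⊤ : Submodule ℂ V) := by
        intro v
        rw [inf_eq_right.2 hDU, inf_eq_right.2 (hDU.trans le_sup_left)]
      by_cases hK : rad E U ⊓ rad D U ≤ rad D ⊤
      · have hlt : finrank ℂ U < finrank ℂ V := by omega
        have hu0 : finrank ℂ (rad E U ⊓ rad D U : Submodule ℂ V)
            ≤ finrank ℂ (rad E U ⊓ rad D ⊤ : Submodule ℂ V) :=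
          Submodule.finrank_mono (le_inf inf_le_left hK)
        -- For a matching pair (v,w), the vector v - w is E'-orthogonal to U with value `prodForm` +
        -- q. A value ≥ 0 protects the negative index; the value 0, needed once the positive index
        -- has reached p, protects both. Strict positivity of q keeps the common radical of E' and D
        -- inside U.
        have : ∃ x ∈ matching D E U, x.1 ∉ U ∧ ∃ q : ℝ, 0 < q ∧
            0 ≤ (prodForm D E x x).re + q ∧
            (posIdx E U < p ∨ (prodForm D E x x).re + q = 0) := by
          by_cases hpE : posIdx E U < p
          · obtain ⟨x, hx, hxU⟩ := exists_matching_notMem hD hE hlt hK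
            refine ⟨x, hx, hxU, |(prodForm D E x x).re| + 1, by positivity, ?_, Or.inl hpE⟩
            have := neg_abs_le (prodForm D E x x).re
            linarith
          · obtain ⟨x, hx, hxU, hneg⟩ := exists_matching_neg hD hE hlt hK (by
              rw [inf_eq_right.2 hDU] at hp2
              omega)
            exact ⟨x, hx, hxU, -(prodForm D E x x).re, by linarith, by simp, Or.inr (by simp)⟩
        obtain ⟨⟨v, w⟩, hx, hv, q, hq, hc0, hc⟩ := this
        obtain ⟨hw, hvw⟩ := mem_matching.1 hx
        dsimp only at hv hw hvw
        rw [prodForm_apply, Complex.sub_re] at hc0 hc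
        dsimp only at hc0 hc
        obtain ⟨E', h1, h2, h3, h4⟩ := exists_extension_step hD hE hDE hv hq.le
        have horth : v - w ∈ orth E' U := fun u hu => by
          rw [map_sub, h1.herm u v, h2 u hu, ← hD u v, hvw u hu, h1.agree u hu w hw, sub_self]
        have hval : (E' (v - w) (v - w)).re = (D v v).re - (E w w).re + q := by
          have e1 : E' v w = E w w := by rw [h2 w hw, hD, hvw w hw, ← hE]
          rw [sub_eq_add_neg, h1.herm.re_add, h3, map_neg, map_neg, LinearMap.neg_apply, map_neg,
            h1.agree w hw w hw, e1, neg_neg, Complex.neg_re]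
          ring
        have hspan : U ⊔ Submodule.span ℂ {v} = U ⊔ Submodule.span ℂ {v - w} := by
          apply le_antisymm <;> refine sup_le le_sup_left ?_ <;>
            rw [Submodule.span_singleton_le_iff_mem]
          · exact mem_sup_span_singleton.2 ⟨w, hw, 1, by simp⟩
          · exact mem_sup_span_singleton.2 ⟨-w, U.neg_mem hw, 1, by simp; abel⟩
        have hpos : posIdx E' (U ⊔ Submodule.span ℂ {v}) ≤ p := by
          rcases hc with hc | hc
          · have := posIdx_sup_span_le_succ E' hv
            rw [posIdx_congr h1.agree] at this
            omega
          · have := posIdx_sup_span_le h1.herm horth (by rw [hval]; exact hc.le)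
            rw [posIdx_congr h1.agree, ← hspan] at this
            have h5 := Submodule.finrank_mono (show rad E U ⊓ rad D ⊤ ≤ rad E U ⊓ rad D U from
              fun x hx => ⟨hx.1, hx.1.1, fun u _ => hx.2.2 u trivial⟩)
            omega
        have hneg : posIdx (-E') (U ⊔ Submodule.span ℂ {v}) ≤ posIdx (-E) U := by
          have := posIdx_sup_span_le h1.herm.neg (U := U) (v := v - w)
            (fun u hu => by rw [LinearMap.neg_apply, LinearMap.neg_apply, horth u hu, neg_zero])
            (by rw [LinearMap.neg_apply, LinearMap.neg_apply, Complex.neg_re, hval]; linarith)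
          rwa [posIdx_neg_congr h1.agree, ← hspan] at this
        have hsub : rad E' (U ⊔ Submodule.span ℂ {v}) ⊓ rad D (U ⊔ Submodule.span ℂ {v})
            ≤ U := by
          intro x hx
          obtain ⟨u, hu, c, rfl⟩ := mem_sup_span_singleton.1 hx.1.1
          have h5 := h4 u hu c
          rw [hx.1.2 _ hx.1.1, hx.2.2 _ hx.1.1, sub_self] at h5
          have h6 := hDE u hu
          have h7 : Complex.normSq c * q ≤ 0 := by linarith
          have h8 : Complex.normSq c = 0 := by
            have := Complex.normSq_nonneg c
            nlinarith
          rw [Complex.normSq_eq_zero] at h8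
          simpa [h8] using hu
        have h5 := Submodule.finrank_mono (hu2 v E' h1)
        rw [inf_eq_left.2 hsub] at h5
        have h6 := Submodule.finrank_mono (rad_inf_rad_le_of_extension hD le_sup_left h1)
        have h7 := hu1 v
        exact ⟨v, hv, E', h1, by omega, by omega, by omega⟩
      -- Adjoining a v with D(k,v) ≠ 0 may raise each index by one, but it removes k from the common
      -- radical, so index plus dimension does not grow.
      · obtain ⟨k, hk, hkD⟩ := SetLike.not_le_iff_exists.1 hK
        have : ∃ v, D k v ≠ 0 := by
          by_contra! h
          exact hkD ⟨trivial, fun u _ => h u⟩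
        obtain ⟨v, hkv⟩ := this
        have hv : v ∉ U := fun h => hkv (hk.2.2 v h)
        have hvk : D v k ≠ 0 := fun h => hkv (hD.swap_eq_zero h)
        obtain ⟨E', h1, h2, h3, -⟩ := exists_extension_step hD hE hDE hv le_rfl
        have hsub : rad D (U ⊔ Submodule.span ℂ {v}) ≤ U := by
          intro x hx
          obtain ⟨u, hu, c, rfl⟩ := mem_sup_span_singleton.1 hx.1
          have := hx.2 k (Submodule.mem_sup_left hk.1.1)
          rw [map_add, LinearMap.add_apply, map_smulₛₗ, LinearMap.smul_apply,
            hD.swap_eq_zero (hk.2.2 u hu), zero_add, smul_eq_mul] at this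
          have hc : c = 0 := by simpa [hvk] using this
          simpa [hc] using hu
        have h5 : rad E' (U ⊔ Submodule.span ℂ {v}) ⊓ rad D (U ⊔ Submodule.span ℂ {v})
            ≤ (rad E U ⊓ rad D U) ⊓ LinearMap.ker (D v) := by
          intro x hx
          refine ⟨hu2 v E' h1 ⟨hx, hsub hx.2⟩, hD.swap_eq_zero (hx.2.2 v ?_)⟩
          exact Submodule.mem_sup_right (Submodule.mem_span_singleton_self v)
        have h6 := Submodule.finrank_mono h5
        have h7 := finrank_inf_ker_lt hk hvk
        have h8 := Submodule.finrank_mono (rad_inf_rad_le_of_extension hD le_sup_left h1)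
        have h9 := posIdx_sup_span_le_succ E' hv
        have h10 := posIdx_sup_span_le_succ (-E') hv
        rw [posIdx_congr h1.agree] at h9
        rw [posIdx_neg_congr h1.agree] at h10
        have h11 := hu1 v
        exact ⟨v, hv, E', h1, by omega, by omega, by omega⟩
    -- A radical vector of D outside U, adjoined with q = 0, is radical for E': no index rises, and
    -- each radical dimension on the left grows by at most the one gained on the right.
    · obtain ⟨v, hvD, hv⟩ := SetLike.not_le_iff_exists.1 hDU
      obtain ⟨E', h1, h2, h3, -⟩ := exists_extension_step hD hE hDE hv le_rfl
      have hv0 : ∀ u ∈ U, E' v u = 0 := fun u hu => by rw [h2 u hu, hvD.2 u trivial]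
      have horth : v ∈ orth E' U := fun u hu => h1.herm.swap_eq_zero (hv0 u hu)
      have hvv : (E' v v).re = 0 := by rw [h3, hvD.2 v trivial]; simp
      have hvv' : E' v v = 0 := by rw [h1.herm.apply_self, hvv]; simp
      have hvmem : v ∈ U ⊔ Submodule.span ℂ {v} :=
        Submodule.mem_sup_right (Submodule.mem_span_singleton_self v)
      have h4 := posIdx_sup_span_le h1.herm horth hvv.le
      have h5 := posIdx_sup_span_le h1.herm.neg (U := U) (v := v)
        (fun u hu => by simpa using horth u hu) (by simp [hvv])
      rw [posIdx_congr h1.agree] at h4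
      rw [posIdx_neg_congr h1.agree] at h5
      have h6 := finrank_le_inf_add_one hv (show rad E' (U ⊔ Submodule.span ℂ {v}) ⊓
        rad D (U ⊔ Submodule.span ℂ {v}) ≤ _ from inf_le_left.trans (rad_le _ _))
      have h7 := Submodule.finrank_mono (hu2 v E' h1)
      have h8 := finrank_le_inf_add_one hv
        (inf_le_left : (U ⊔ Submodule.span ℂ {v}) ⊓ rad D ⊤ ≤ _)
      have h9 : ((U ⊔ Submodule.span ℂ {v}) ⊓ rad D ⊤) ⊓ U ≤ U ⊓ rad D ⊤ :=
        fun x hx => ⟨hx.2, hx.1.2⟩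
      have h10 := Submodule.finrank_mono h9
      have hvr : v ∈ rad E' (U ⊔ Submodule.span ℂ {v}) := by
        refine ⟨hvmem, fun y hy => ?_⟩
        obtain ⟨u, hu, c, rfl⟩ := mem_sup_span_singleton.1 hy
        rw [map_add, map_smul, hv0 u hu, hvv']
        simp
      have h11 : (rad E U ⊓ rad D ⊤) ⊔ Submodule.span ℂ {v}
          ≤ rad E' (U ⊔ Submodule.span ℂ {v}) ⊓ rad D ⊤ :=
        sup_le (rad_inf_rad_le_of_extension hD le_sup_left h1)
          ((Submodule.span_singleton_le_iff_mem _ _).2 ⟨hvr, hvD⟩)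
      have h12 := Submodule.finrank_mono h11
      rw [Submodule.finrank_sup_span_singleton (fun h : v ∈ rad E U ⊓ rad D ⊤ => hv h.1.1)] at h12
      exact ⟨v, hv, E', h1, by omega, by omega, by omega⟩

end MinimalExtension

end LMI

/-! ### Bounds valid for every dominating extension -/

namespace LMI

open Module

section Bounds

variable {V : Type*} [AddCommGroup V] [Module ℂ V] {D E M : Form V} {U : Submodule ℂ V}

theorem rad_neg (E : Form V) (U : Submodule ℂ V) : rad (-E) U = rad E U := by
  ext x; simp [mem_rad]

/-- Such a vector is null for M - D ≥ 0, so D(x,·) = M(x,·) = 0 on the whole space. -/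
theorem IsExtension.rad_inf_le (hD : IsHerm D) (h : IsExtension D E U ⊤ M) :
    (rad E U ⊓ rad D U) ⊓ rad M ⊤ ≤ rad E U ⊓ rad D ⊤ := by
  refine fun x hx => ⟨hx.1.1, trivial, fun u hu => ?_⟩
  rw [← form_ext_re hD h.herm h.dom (x := x) trivial hu, hx.2.2 u hu]
  rw [hx.2.2 x trivial, hx.1.2.2 x hx.1.1.1]

variable [FiniteDimensional ℂ V]

theorem posIdx_extension_add_le (h : IsExtension D E U ⊤ M) :
    posIdx M ⊤ + finrank ℂ U ≤ posIdx E U + finrank ℂ V := by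
  have := posIdx_add_finrank_le (D := M) (le_top (a := U))
  rwa [posIdx_congr h.agree, finrank_top] at this

theorem negIdx_extension_add_le (h : IsExtension D E U ⊤ M) :
    posIdx (-M) ⊤ + finrank ℂ U ≤ posIdx (-E) U + finrank ℂ V := by
  have := posIdx_add_finrank_le (D := -M) (le_top (a := U))
  rwa [posIdx_neg_congr h.agree, finrank_top] at this

theorem negIdx_extension_le (h : IsExtension D E U ⊤ M) : posIdx (-M) ⊤ ≤ posIdx (-D) ⊤ :=
  posIdx_mono_form fun x hx => by simpa using h.dom x hx

/-- Common radical vectors on U outside rad D cannot stay radical for M, so they pair with something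
and each independent one raises the index. -/
theorem le_posIdx_extension (hD : IsHerm D) (h : IsExtension D E U ⊤ M) :
    posIdx E U + finrank ℂ (rad E U ⊓ rad D U : Submodule ℂ V)
      ≤ posIdx M ⊤ + finrank ℂ (rad E U ⊓ rad D ⊤ : Submodule ℂ V) := by
  have h1 := posIdx_add_finrank_le_of_rad h.herm (V₀ := ⊤) (rad E U ⊓ rad D U) U le_top
    (by rw [rad_congr h.agree]; exact inf_le_left)
  rw [posIdx_congr h.agree] at h1
  exact h1.trans (Nat.add_le_add_left (Submodule.finrank_mono (h.rad_inf_le hD)) _)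

theorem le_negIdx_extension (hD : IsHerm D) (h : IsExtension D E U ⊤ M) :
    posIdx (-E) U + finrank ℂ (rad E U ⊓ rad D U : Submodule ℂ V)
      ≤ posIdx (-M) ⊤ + finrank ℂ (rad E U ⊓ rad D ⊤ : Submodule ℂ V) := by
  have h1 := posIdx_add_finrank_le_of_rad h.herm.neg (V₀ := ⊤) (rad E U ⊓ rad D U) U le_top
    (by rw [rad_neg, rad_congr h.agree]; exact inf_le_left)
  rw [posIdx_neg_congr h.agree, rad_neg] at h1
  exact h1.trans (Nat.add_le_add_left (Submodule.finrank_mono (h.rad_inf_le hD)) _)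

/-- M is nonnegative on P ⊕ (U ∩ rad D), where P is maximal positive for D. A vector of this sum
that is radical for M has no P-component, so it lies in rad E|U ∩ rad D. -/
theorem posIdx_dominated_add_le (hD : IsHerm D) (h : IsExtension D E U ⊤ M) :
    posIdx D ⊤ + finrank ℂ (U ⊓ rad D ⊤ : Submodule ℂ V)
      ≤ posIdx M ⊤ + finrank ℂ (rad E U ⊓ rad D ⊤ : Submodule ℂ V) := by
  obtain ⟨P, -, hP, e⟩ := exists_posIdx D ⊤
  have hval : ∀ p ∈ P, ∀ r ∈ U ⊓ rad D ⊤, (D (p + r) (p + r)).re = (D p p).re := by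
    intro p _ r hr
    rw [hD.re_add, hr.2.2 r trivial, hD.swap_eq_zero (hr.2.2 p trivial)]
    simp
  have hP0 : ∀ p ∈ P, 0 ≤ (D p p).re := fun p hp => by
    by_cases h0 : p = 0
    · simp [h0]
    · exact (hP p hp h0).le
  have h1 := finrank_le_posIdx_of_nonneg h.herm (W := P ⊔ (U ⊓ rad D ⊤)) le_top (by
    intro x hx
    obtain ⟨p, hp, r, hr, rfl⟩ := Submodule.mem_sup.1 hx
    have := h.dom (p + r) trivial
    rw [hval p hp r hr] at this
    exact (hP0 p hp).trans this)
  have h2 : (P ⊔ (U ⊓ rad D ⊤)) ⊓ rad M ⊤ ≤ rad E U ⊓ rad D ⊤ := by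
    rintro x ⟨hx, hx'⟩
    obtain ⟨p, hp, r, hr, rfl⟩ := Submodule.mem_sup.1 hx
    have h3 := h.dom (p + r) trivial
    rw [hval p hp r hr, hx'.2 _ trivial, Complex.zero_re] at h3
    have hp0 : p = 0 := by
      by_contra h0
      exact absurd (hP p hp h0) (not_lt.2 h3)
    rw [hp0, zero_add] at hx' ⊢
    exact ⟨⟨hr.1, fun u hu => by rw [← h.agree r hr.1 u hu, hx'.2 u trivial]⟩, hr.2⟩
  have h3 := Submodule.finrank_mono h2
  have h4 := Submodule.finrank_sup_add_finrank_inf_eq P (U ⊓ rad D ⊤)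
  have h5 : P ⊓ (U ⊓ rad D ⊤) = ⊥ := by
    rw [Submodule.eq_bot_iff]
    intro x hx
    by_contra h0
    have := hP x hx.1 h0
    simp [hx.2.2.2 x trivial] at this
  rw [h5, finrank_bot] at h4
  omega

theorem finrank_rad_le_extension (hD : IsHerm D) (h : IsExtension D E U ⊤ M) :
    finrank ℂ (rad E U ⊓ rad D ⊤ : Submodule ℂ V) ≤ finrank ℂ (rad M ⊤) :=
  Submodule.finrank_mono ((rad_inf_rad_le_of_extension hD le_top h).trans inf_le_left)

theorem re_nonpos_of_posIdx_eq_zero (hD : IsHerm D) (h : posIdx D ⊤ = 0) (x : V) :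
    (D x x).re ≤ 0 := by
  obtain ⟨N, -, hN, e⟩ := exists_nonpos_complement hD ⊤
  rw [h, zero_add, finrank_top] at e
  have hN' : N = ⊤ := Submodule.eq_top_of_finrank_eq e
  exact hN x (hN' ▸ trivial)

/-- When D ≤ 0, a D-null vector is radical for D everywhere. This gives u₂ ≤ u₀, which part (d)
needs. -/
theorem finrank_rad_inf_rad_le (hD : IsHerm D) (h : posIdx D ⊤ = 0) :
    finrank ℂ (rad E U ⊓ rad D U : Submodule ℂ V)
      ≤ finrank ℂ (rad E U ⊓ rad D ⊤ : Submodule ℂ V) := by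
  refine Submodule.finrank_mono fun x hx => ⟨hx.1, trivial, fun u _ => ?_⟩
  have h1 := hD.neg.eq_zero_of_null (U := ⊤) (x := x) (y := u)
    (fun z _ => by simpa using re_nonpos_of_posIdx_eq_zero hD h z)
    trivial trivial (by simp [hx.2.2 x hx.2.1])
  simpa using h1

/-- The index of a bordered form. -/
theorem posIdx_bordered {V' : Type*} [AddCommGroup V'] [Module ℂ V'] [FiniteDimensional ℂ V']
    {F : Form V'} (hF : IsHerm F) {l : V' →ₗ[ℂ] V} (hl : Function.Surjective l)
    (hval : ∀ z, l z ∈ U → (F z z).re = (E (l z) (l z)).re)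
    (hker : ∀ z, l z = 0 → ∀ z', l z' ∈ U → F z z' = 0) {a : ℕ}
    (ha : finrank ℂ U + a = finrank ℂ V)
    (ha' : finrank ℂ (LinearMap.ker l ⊓ rad F ⊤ : Submodule ℂ V') + a
      = finrank ℂ (LinearMap.ker l)) :
    posIdx F ⊤ = a + posIdx E U := by
  have hfin : ∀ W : Submodule ℂ V,
      finrank ℂ (W.comap l) = finrank ℂ W + finrank ℂ (LinearMap.ker l) := by
    intro W
    have h := finrank_map_add_finrank_inf_ker l (W.comap l)
    rw [Submodule.map_comap_eq_of_surjective hl, inf_eq_right.2 (LinearMap.ker_le_comap l)] at h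
    exact h.symm
  apply le_antisymm
  -- The preimage of U has codimension a, and a positive subspace of it meets the null space ker l
  -- trivially, so it embeds in U.
  · have h1 := posIdx_add_finrank_le (D := F) (le_top (a := U.comap l))
    have h2 : posIdx F (U.comap l) ≤ posIdx E U := by
      refine posIdx_le fun W hW hpos => ?_
      have h3 : W ⊓ LinearMap.ker l = ⊥ := by
        rw [Submodule.eq_bot_iff]
        intro x hx
        by_contra h0
        have := hpos x hx.1 h0
        rw [hker x hx.2 x (hW hx.1)] at this
        simp at this
      have h4 := finrank_map_add_finrank_inf_ker l W
      rw [h3, finrank_bot, add_zero] at h4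
      rw [← h4]
      refine le_posIdx (by rintro _ ⟨x, hx, rfl⟩; exact hW hx) ?_
      rintro _ ⟨x, hx, rfl⟩ h0
      rw [← hval x (hW hx)]
      exact hpos x hx (by rintro rfl; simp at h0)
    have h3 := hfin U
    have h4 := hfin ⊤
    rw [Submodule.comap_top, finrank_top, finrank_top] at h4
    rw [finrank_top] at h1
    omega
  · obtain ⟨W, hWU, hW, e⟩ := exists_posIdx E U
    -- The preimage of a positive `W` is nonnegative, and its radical vectors lie in ker l ∩ rad F,
    -- which is smaller than ker l by a.
    have hn : ∀ x ∈ W.comap l, 0 ≤ (F x x).re := by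
      intro x hx
      rw [hval x (hWU hx)]
      by_cases h0 : l x = 0
      · simp [h0]
      · exact (hW _ hx h0).le
    have h1 := finrank_le_posIdx_of_nonneg hF (le_top (a := W.comap l)) hn
    have h2 : W.comap l ⊓ rad F ⊤ ≤ LinearMap.ker l ⊓ rad F ⊤ := by
      refine fun x hx => ⟨?_, hx.2⟩
      by_contra h0
      have := hW _ hx.1 h0
      rw [← hval x (hWU hx.1), hx.2.2 x trivial] at this
      simp at this
    have h3 := Submodule.finrank_mono h2
    have h4 := hfin W
    omega

end Bounds

/-! ### Matrices as forms and the law of inertia -/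

section MatrixForms

open Matrix
open scoped ComplexOrder

theorem rank_add_finrank_ker {ι κ : Type*} [Fintype κ] (M : Matrix ι κ ℂ) :
    M.rank + finrank ℂ (LinearMap.ker M.mulVecLin) = Fintype.card κ := by
  have := LinearMap.finrank_range_add_finrank_ker M.mulVecLin
  rwa [Module.finrank_fintype_fun_eq_card] at this

variable {ι : Type*} [Fintype ι]

/-- The sesquilinear form of a square matrix. -/
noncomputable def matForm (M : Matrix ι ι ℂ) : Form (ι → ℂ) :=
  LinearMap.mk₂'ₛₗ (starRingEnd ℂ) (RingHom.id ℂ)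
    (fun x y => star x ⬝ᵥ (M *ᵥ y))
    (by intros; simp [add_dotProduct])
    (by intros; simp)
    (by intros; simp [mulVec_add, dotProduct_add])
    (by intros; simp [mulVec_smul])

theorem matForm_apply (M : Matrix ι ι ℂ) (x y : ι → ℂ) :
    matForm M x y = star x ⬝ᵥ (M *ᵥ y) := rfl

theorem star_dotProduct_mulVec {κ : Type*} [Fintype κ] (M : Matrix ι κ ℂ) (x : ι → ℂ)
    (y : κ → ℂ) : star x ⬝ᵥ (M *ᵥ y) = star (Mᴴ *ᵥ x) ⬝ᵥ y := by
  rw [star_mulVec, conjTranspose_conjTranspose, dotProduct_mulVec]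

theorem isHerm_matForm {M : Matrix ι ι ℂ} (hM : M.IsHermitian) : IsHerm (matForm M) :=
  fun x y => by
    rw [matForm_apply, matForm_apply, star_dotProduct_mulVec, hM.eq, star_dotProduct]

theorem matForm_neg (M : Matrix ι ι ℂ) : matForm (-M) = -matForm M := by
  ext x y
  simp [matForm_apply, neg_mulVec]

theorem matForm_sub_apply (M N : Matrix ι ι ℂ) (x y : ι → ℂ) :
    matForm (M - N) x y = matForm M x y - matForm N x y := by
  simp [matForm_apply, sub_mulVec]

theorem forall_star_dotProduct_eq_zero {v : ι → ℂ} :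
    (∀ u : ι → ℂ, star u ⬝ᵥ v = 0) ↔ v = 0 :=
  ⟨fun h => dotProduct_star_self_eq_zero.1 (by simpa [dotProduct_comm] using h v),
    fun h => by simp [h]⟩

theorem mem_rad_matForm_top {M : Matrix ι ι ℂ} (hM : M.IsHermitian) {x : ι → ℂ} :
    x ∈ rad (matForm M) ⊤ ↔ M *ᵥ x = 0 := by
  rw [← forall_star_dotProduct_eq_zero]
  exact ⟨fun h u => (isHerm_matForm hM).swap_eq_zero (h.2 u trivial),
    fun h => ⟨trivial, fun u _ => (isHerm_matForm hM).swap_eq_zero (h u)⟩⟩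

theorem rank_add_finrank_ker_conjTranspose {κ : Type*} [Fintype κ] (M : Matrix ι κ ℂ) :
    M.rank + finrank ℂ (LinearMap.ker Mᴴ.mulVecLin) = Fintype.card ι := by
  rw [← rank_conjTranspose, rank_add_finrank_ker]

/-- Killing the coordinates with μ > 0 leaves a nonpositive subspace, killing the others a positive
one; the two dimensions squeeze the index. -/
theorem posIdx_of_diag {F : Form (ι → ℂ)} (e : (ι → ℂ) ≃ₗ[ℂ] (ι → ℂ)) (μ : ι → ℝ)
    (hF : ∀ x, (F x x).re = ∑ i, μ i * Complex.normSq (e x i)) :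
    posIdx F ⊤ = Fintype.card {i // 0 < μ i} := by
  classical
  let g (p : ι → Prop) : (ι → ℂ) →ₗ[ℂ] ({i // p i} → ℂ) :=
    LinearMap.funLeft ℂ ℂ Subtype.val ∘ₗ e.toLinearMap
  have hg : ∀ p x, x ∈ LinearMap.ker (g p) ↔ ∀ i, p i → e x i = 0 := by
    intro p x
    rw [LinearMap.mem_ker, funext_iff, Subtype.forall]
    rfl
  apply le_antisymm
  · have h := finrank_le_inf_ker_add (g fun i => 0 < μ i) ⊤
    have h1 := posIdx_add_finrank_le_of_nonpos (D := F)
      (inf_le_left : ⊤ ⊓ LinearMap.ker (g fun i => 0 < μ i) ≤ ⊤) (fun x hx => by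
        rw [hF]
        refine Finset.sum_nonpos fun i _ => ?_
        by_cases hi : 0 < μ i
        · rw [(hg _ x).1 hx.2 i hi]; simp
        · exact mul_nonpos_of_nonpos_of_nonneg (not_lt.1 hi) (Complex.normSq_nonneg _))
    rw [Module.finrank_fintype_fun_eq_card] at h
    omega
  · have h := finrank_le_inf_ker_add (g fun i => ¬ 0 < μ i) ⊤
    have h1 := le_posIdx (D := F) (U := ⊤)
      (W := ⊤ ⊓ LinearMap.ker (g fun i => ¬ 0 < μ i)) le_top (fun x hx hx0 => by
        have hz := (hg _ x).1 hx.2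
        have hnn : ∀ i, 0 ≤ μ i * Complex.normSq (e x i) := by
          intro i
          by_cases hi : 0 < μ i
          · exact mul_nonneg hi.le (Complex.normSq_nonneg _)
          · rw [hz i hi]; simp
        rw [hF]
        refine lt_of_le_of_ne (Finset.sum_nonneg fun i _ => hnn i) fun h0 => hx0 ?_
        have h0' := (Finset.sum_eq_zero_iff_of_nonneg fun i _ => hnn i).1 h0.symm
        rw [← e.map_eq_zero_iff]
        funext i
        by_cases hi : 0 < μ i
        · have := h0' i (Finset.mem_univ i)
          simpa [hi.ne'] using this
        · exact hz i hi)
    have h2 := Fintype.card_subtype_compl (fun i => 0 < μ i)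
    have h3 := Fintype.card_subtype_le (fun i => 0 < μ i)
    rw [Module.finrank_fintype_fun_eq_card, finrank_top, Module.finrank_fintype_fun_eq_card] at h
    omega

theorem rank_eq_add {M : Matrix ι ι ℂ} (hM : M.IsHermitian) :
    M.rank = posIdx (matForm M) ⊤ + posIdx (-matForm M) ⊤ := by
  have h1 := posIdx_add_negIdx_add_rad (isHerm_matForm hM) ⊤
  have h2 := rank_add_finrank_ker M
  have h3 : rad (matForm M) ⊤ = LinearMap.ker M.mulVecLin := by
    ext x
    rw [mem_rad_matForm_top hM]
    rfl
  rw [finrank_top, Module.finrank_fintype_fun_eq_card, h3] at h1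
  omega

theorem posDef_iff {M : Matrix ι ι ℂ} (hM : M.IsHermitian) :
    M.PosDef ↔ Fintype.card ι ≤ posIdx (matForm M) ⊤ := by
  rw [← Module.finrank_fintype_fun_eq_card (R := ℂ) (η := ι)]
  constructor
  · intro h
    rw [← finrank_top ℂ (ι → ℂ)]
    exact le_posIdx le_rfl fun x _ hx => (Complex.pos_iff.1 (h.dotProduct_mulVec_pos hx)).1
  · intro h
    obtain ⟨W, -, hW, e⟩ := exists_posIdx (matForm M) ⊤
    have hW' : W = ⊤ := Submodule.eq_top_of_finrank_eq
      (le_antisymm (Submodule.finrank_le W) (e ▸ h))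
    refine .of_dotProduct_mulVec_pos hM fun x hx => ?_
    have h1 := hW x (hW' ▸ trivial) hx
    rw [← matForm_apply, (isHerm_matForm hM).apply_self]
    exact_mod_cast h1

theorem posSemidef_iff_re {M : Matrix ι ι ℂ} (hM : M.IsHermitian) :
    M.PosSemidef ↔ ∀ x, 0 ≤ (matForm M x x).re := by
  constructor
  · exact fun h x => (Complex.nonneg_iff.1 (h.dotProduct_mulVec_nonneg x)).1
  · refine fun h => .of_dotProduct_mulVec_nonneg hM fun x => ?_
    rw [← matForm_apply, (isHerm_matForm hM).apply_self]
    exact_mod_cast h x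

theorem posSemidef_iff {M : Matrix ι ι ℂ} (hM : M.IsHermitian) :
    M.PosSemidef ↔ posIdx (-matForm M) ⊤ = 0 := by
  rw [posSemidef_iff_re hM]
  constructor
  · intro h
    have := posIdx_add_finrank_le_of_nonpos (D := -matForm M) (le_refl (⊤ : Submodule ℂ (ι → ℂ)))
      (fun x _ => by simpa using h x)
    omega
  · intro h x
    simpa using re_nonpos_of_posIdx_eq_zero (isHerm_matForm hM).neg h x

variable [DecidableEq ι]

theorem exists_diagonalization {M : Matrix ι ι ℂ} (hM : M.IsHermitian) :
    ∃ e : (ι → ℂ) ≃ₗ[ℂ] (ι → ℂ),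
      ∀ x, (matForm M x x).re = ∑ i, hM.eigenvalues i * Complex.normSq (e x i) := by
  obtain ⟨Q, hQ⟩ : ∃ Q : Matrix ι ι ℂ, Q = hM.eigenvectorUnitary := ⟨_, rfl⟩
  have h1 : Q * Qᴴ = 1 := by rw [hQ]; exact Unitary.coe_mul_star_self hM.eigenvectorUnitary
  have h2 : Qᴴ * Q = 1 := by rw [hQ]; exact Unitary.coe_star_mul_self hM.eigenvectorUnitary
  have hM' : M = Q * diagonal (fun i => (hM.eigenvalues i : ℂ)) * Qᴴ := by
    have := hM.spectral_theorem
    rw [Unitary.conjStarAlgAut_apply, ← hQ] at this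
    exact this
  refine ⟨Matrix.toLin'OfInv h1 h2, fun x => ?_⟩
  have h3 : matForm M x x = star (Qᴴ *ᵥ x) ⬝ᵥ
      (diagonal (fun i => (hM.eigenvalues i : ℂ)) *ᵥ (Qᴴ *ᵥ x)) := by
    rw [← star_dotProduct_mulVec, mulVec_mulVec, mulVec_mulVec, ← hM',
      matForm_apply]
  rw [h3]
  simp only [dotProduct, mulVec_diagonal, Complex.re_sum, toLin'OfInv_apply, toLin'_apply]
  refine Finset.sum_congr rfl fun i _ => ?_
  rw [mul_left_comm, Complex.re_ofReal_mul, Pi.star_apply, Complex.star_def,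
    ← Complex.normSq_eq_conj_mul_self, Complex.ofReal_re]

/-- Sylvester's law of inertia. -/
theorem posIdx_matForm {M : Matrix ι ι ℂ} (hM : M.IsHermitian) :
    posIdx (matForm M) ⊤ = posInertia M := by
  obtain ⟨e, he⟩ := exists_diagonalization hM
  rw [posInertia_eq_card hM, posIdx_of_diag e _ he]

theorem negIdx_matForm {M : Matrix ι ι ℂ} (hM : M.IsHermitian) :
    posIdx (-matForm M) ⊤ = negInertia M := by
  obtain ⟨e, he⟩ := exists_diagonalization hM
  rw [negInertia_eq_card hM, posIdx_of_diag e (fun i => -hM.eigenvalues i) (by simp [he])]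
  simp

end MatrixForms

end LMI

/-! ### From matrices to extensions: solutions, inertia of N, block ranks -/

namespace LMI

open Module

section MainProof

open Matrix
open scoped ComplexOrder

variable {m n : ℕ} {A : Matrix (Fin m) (Fin n) ℂ} {B C : Matrix (Fin m) (Fin m) ℂ}

/-- The kernel of the conjugate transpose. -/
noncomputable def coker (A : Matrix (Fin m) (Fin n) ℂ) : Submodule ℂ (Fin m → ℂ) :=
  LinearMap.ker Aᴴ.mulVecLin

theorem mem_coker {x : Fin m → ℂ} : x ∈ coker A ↔ Aᴴ *ᵥ x = 0 := Iff.rfl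

theorem rank_add_finrank_coker (A : Matrix (Fin m) (Fin n) ℂ) :
    A.rank + finrank ℂ (coker A) = m := by
  have := rank_add_finrank_ker_conjTranspose A
  rwa [Fintype.card_fin] at this

/-- The normal equations are solvable for every column because A*A and A* have the same range. The
product AG is then the orthogonal projection onto the range of A. -/
theorem exists_left_inverse (A : Matrix (Fin m) (Fin n) ℂ) :
    ∃ G : Matrix (Fin n) (Fin m) ℂ, Aᴴ * (A * G) = Aᴴ := by
  have h1 : LinearMap.range (Aᴴ * A).mulVecLin = LinearMap.range Aᴴ.mulVecLin := by
    refine Submodule.eq_of_le_of_finrank_eq ?_ ?_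
    · rintro _ ⟨x, rfl⟩
      exact ⟨A *ᵥ x, by simp⟩
    · exact (rank_conjTranspose_mul_self A).trans (rank_conjTranspose A).symm
  have h2 : ∀ j, ∃ g : Fin n → ℂ, (Aᴴ * A) *ᵥ g = Aᴴ.col j := by
    intro j
    have : Aᴴ.col j ∈ LinearMap.range (Aᴴ * A).mulVecLin := by
      rw [h1]
      exact ⟨Pi.single j 1, by simp⟩
    exact this
  choose g hg using h2
  refine ⟨(Matrix.of g)ᵀ, ?_⟩
  rw [← Matrix.mul_assoc]
  ext i j
  exact congrFun (hg j) i

theorem mem_range_iff {v : Fin m → ℂ} :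
    (∃ y, A *ᵥ y = v) ↔ ∀ u ∈ coker A, star u ⬝ᵥ v = 0 := by
  constructor
  · rintro ⟨y, rfl⟩ u hu
    rw [star_dotProduct_mulVec, mem_coker.1 hu]
    simp
  · intro h
    obtain ⟨G, hG⟩ := exists_left_inverse A
    have hu : v - A *ᵥ (G *ᵥ v) ∈ coker A := by
      rw [mem_coker, mulVec_sub, mulVec_mulVec, mulVec_mulVec, Matrix.mul_assoc, hG, sub_self]
    refine ⟨G *ᵥ v, ?_⟩
    have h1 := h _ hu
    have h2 : star (v - A *ᵥ (G *ᵥ v)) ⬝ᵥ (v - A *ᵥ (G *ᵥ v)) = 0 := by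
      rw [dotProduct_sub, h1, star_dotProduct_mulVec, mem_coker.1 hu]
      simp
    exact (sub_eq_zero.1 (dotProduct_star_self_eq_zero.1 h2)).symm

/-- Hermitian matrices whose form vanishes on the cokernel of `A` are of the form
`A X + (A X)*`. -/
theorem exists_lyap_eq {Y : Matrix (Fin m) (Fin m) ℂ} (hY : Y.IsHermitian)
    (h : ∀ x ∈ coker A, ∀ y ∈ coker A, matForm Y x y = 0) : ∃ X, lyap A X = Y := by
  obtain ⟨G, hG⟩ := exists_left_inverse A
  obtain ⟨P, hP⟩ : ∃ P, P = A * G := ⟨_, rfl⟩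
  rw [← hP] at hG
  have hPP : Pᴴ * P = Pᴴ := by
    rw [hP, conjTranspose_mul, Matrix.mul_assoc, ← hP, hG]
  have hPh : Pᴴ = P := by
    have := congrArg conjTranspose hPP
    rw [conjTranspose_mul, conjTranspose_conjTranspose, hPP] at this
    exact this
  have hmem : ∀ x, (1 - P) *ᵥ x ∈ coker A := fun x => by
    rw [mem_coker, mulVec_mulVec, Matrix.mul_sub, hG, Matrix.mul_one, sub_self, zero_mulVec]
  have hz : (1 - P) * Y * (1 - P) = 0 := by
    rw [← Matrix.mulVec_injective.eq_iff]
    funext y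
    rw [zero_mulVec, ← forall_star_dotProduct_eq_zero]
    intro x
    have := h _ (hmem x) _ (hmem y)
    rwa [matForm_apply, star_mulVec, conjTranspose_sub, conjTranspose_one, hPh,
      ← dotProduct_mulVec, mulVec_mulVec, mulVec_mulVec] at this
  have hY' : Y = P * Y + Y * P - P * Y * P := by
    rw [← sub_eq_zero, ← hz]
    noncomm_ring
  -- The factor 1/2 shares the block PYP equally between AX and its adjoint.
  refine ⟨G * (Y - (1 / 2 : ℂ) • (Y * P)), ?_⟩
  have h1 : A * (G * (Y - (1 / 2 : ℂ) • (Y * P))) = P * Y - (1 / 2 : ℂ) • (P * Y * P) := by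
    rw [← Matrix.mul_assoc, ← hP, Matrix.mul_sub, Matrix.mul_smul, Matrix.mul_assoc P]
  have h2 : (P * Y - (1 / 2 : ℂ) • (P * Y * P))ᴴ = Y * P - (1 / 2 : ℂ) • (P * Y * P) := by
    rw [conjTranspose_sub, conjTranspose_smul, conjTranspose_mul, conjTranspose_mul,
      conjTranspose_mul, hPh, hY.eq, ← Matrix.mul_assoc]
    simp
  rw [lyap, h1, h2]
  refine Eq.trans ?_ hY'.symm
  generalize P * Y * P = Z
  module

theorem isHermitian_lyap (A : Matrix (Fin m) (Fin n) ℂ) (X : Matrix (Fin n) (Fin m) ℂ) :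
    (lyap A X).IsHermitian := by
  rw [lyap, Matrix.IsHermitian, conjTranspose_add, conjTranspose_conjTranspose, add_comm]

theorem matForm_lyap {X : Matrix (Fin n) (Fin m) ℂ} {x y : Fin m → ℂ} (hx : x ∈ coker A)
    (hy : y ∈ coker A) : matForm (lyap A X) x y = 0 := by
  have h1 : star x ⬝ᵥ ((A * X) *ᵥ y) = 0 := by
    rw [← mulVec_mulVec, star_dotProduct_mulVec, mem_coker.1 hx]
    simp
  have h2 : (A * X)ᴴ *ᵥ y = 0 := by
    rw [conjTranspose_mul, ← mulVec_mulVec, mem_coker.1 hy, mulVec_zero]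
  rw [matForm_apply, lyap, add_mulVec, dotProduct_add, h1, h2]
  simp

theorem isExtension_of_mem_solSet (hB : B.IsHermitian) (hC : C.IsHermitian)
    {X : Matrix (Fin n) (Fin m) ℂ} (hX : X ∈ solSet A B) :
    IsExtension (matForm (B - C)) (matForm (-C)) (coker A) ⊤ (matForm (lyap A X - C)) := by
  refine ⟨isHerm_matForm ((isHermitian_lyap A X).sub hC), fun x hx y hy => ?_, fun x _ => ?_⟩
  · rw [matForm_sub_apply, matForm_lyap hx hy, matForm_neg]
    simp
  · have h := (posSemidef_iff_re ((isHermitian_lyap A X).sub hB)).1 hX x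
    rw [matForm_sub_apply, Complex.sub_re] at h
    rw [matForm_sub_apply, matForm_sub_apply, Complex.sub_re, Complex.sub_re]
    linarith

theorem exists_matrix_of_isHerm {F : Form (Fin m → ℂ)} (hF : IsHerm F) :
    ∃ M : Matrix (Fin m) (Fin m) ℂ, M.IsHermitian ∧ matForm M = F := by
  refine ⟨Matrix.of fun i j => F (Pi.single i 1) (Pi.single j 1), ?_, ?_⟩
  · ext i j
    exact (hF (Pi.single i 1) (Pi.single j 1)).symm
  · refine (Pi.basisFun ℂ (Fin m)).ext fun i => (Pi.basisFun ℂ (Fin m)).ext fun j => ?_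
    simp [matForm_apply]

/-- If M is the matrix of F, then M + C vanishes on ker A* as a form, so `exists_lyap_eq` solves for
X; domination of D is the inequality defining the solution set. -/
theorem exists_mem_solSet (hB : B.IsHermitian) (hC : C.IsHermitian)
    {F : Form (Fin m → ℂ)}
    (hF : IsExtension (matForm (B - C)) (matForm (-C)) (coker A) ⊤ F) :
    ∃ X ∈ solSet A B, matForm (lyap A X - C) = F := by
  obtain ⟨M, hM, rfl⟩ := exists_matrix_of_isHerm hF.herm
  obtain ⟨X, hX⟩ := exists_lyap_eq (A := A) (hM.add hC) (fun x hx y hy => by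
    have h1 := hF.agree x hx y hy
    have h2 := matForm_sub_apply (M + C) C x y
    rw [add_sub_cancel_right, h1, matForm_neg, LinearMap.neg_apply, LinearMap.neg_apply] at h2
    linear_combination -h2)
  have hX' : lyap A X - C = M := by rw [hX, add_sub_cancel_right]
  refine ⟨X, (posSemidef_iff_re ((isHermitian_lyap A X).sub hB)).2 fun x => ?_, by rw [hX']⟩
  have h := hF.dom x trivial
  rw [← hX', matForm_sub_apply, matForm_sub_apply, Complex.sub_re, Complex.sub_re] at h
  rw [matForm_sub_apply, Complex.sub_re]
  linarith

/-- Cx is orthogonal to ker A* exactly when it lies in the range of A; this is how radicals become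
kernels of block matrices. -/
theorem mem_rad_neg {x : Fin m → ℂ} (hC : C.IsHermitian) :
    x ∈ rad (matForm (-C)) (coker A) ↔ Aᴴ *ᵥ x = 0 ∧ ∃ y, C *ᵥ x + A *ᵥ y = 0 := by
  rw [matForm_neg, rad_neg, mem_rad, mem_coker]
  refine and_congr_right fun hx => ?_
  have h : (∃ y, C *ᵥ x + A *ᵥ y = 0) ↔ ∃ y, A *ᵥ y = C *ᵥ x :=
    ⟨fun ⟨y, hy⟩ => ⟨-y, by rw [mulVec_neg]; exact (eq_neg_of_add_eq_zero_left hy).symm⟩,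
      fun ⟨y, hy⟩ => ⟨-y, by rw [mulVec_neg, hy, add_neg_cancel]⟩⟩
  rw [h, mem_range_iff]
  exact ⟨fun h u hu => (isHerm_matForm hC).swap_eq_zero (h u hu),
    fun h u hu => (isHerm_matForm hC).swap_eq_zero (h u hu)⟩

theorem rank_add_finrank_ker_fin (A : Matrix (Fin m) (Fin n) ℂ) :
    A.rank + finrank ℂ (LinearMap.ker A.mulVecLin) = n := by
  have := rank_add_finrank_ker A
  rwa [Fintype.card_fin] at this

theorem finrank_ker_funLeft_inl {ι κ : Type*} [Fintype ι] [Fintype κ] :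
    finrank ℂ (LinearMap.ker (LinearMap.funLeft ℂ ℂ (Sum.inl : ι → ι ⊕ κ)))
      = Fintype.card κ := by
  have h := LinearMap.finrank_range_add_finrank_ker
    (LinearMap.funLeft ℂ ℂ (Sum.inl : ι → ι ⊕ κ))
  rw [LinearMap.range_eq_top.2 (LinearMap.funLeft_surjective_of_injective ℂ ℂ _
    Sum.inl_injective), finrank_top, Module.finrank_fintype_fun_eq_card,
    Module.finrank_fintype_fun_eq_card, Fintype.card_sum] at h
  omega

/-- The embedding of the second block. -/
noncomputable def inrVec (ι κ : Type*) : (κ → ℂ) →ₗ[ℂ] (ι ⊕ κ → ℂ) where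
  toFun y := Sum.elim 0 y
  map_add' x y := by ext (i | i) <;> simp
  map_smul' c x := by ext (i | i) <;> simp

theorem inrVec_injective (ι κ : Type*) : Function.Injective (inrVec ι κ) := fun x y h => by
  funext i
  exact congrFun h (Sum.inr i)

theorem isHermitian_matN (A : Matrix (Fin m) (Fin n) ℂ) (hC : C.IsHermitian) :
    (matN A C).IsHermitian := IsHermitian.fromBlocks hC rfl isHermitian_zero

/-- `posIdx_bordered` for (x,y) ↦ x: the vectors (0,y) are null, and they are radical only when Ay =
0, which accounts for the summand r(A). -/
theorem posIdx_matN {C : Matrix (Fin m) (Fin m) ℂ} (hC : C.IsHermitian) :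
    posIdx (matForm (matN A C)) ⊤ = A.rank + posIdx (matForm C) (coker A) := by
  have hN := isHermitian_matN A hC
  have happ : ∀ x y x' y', matForm (matN A C) (Sum.elim x y) (Sum.elim x' y')
      = matForm C x x' + star (Aᴴ *ᵥ x) ⬝ᵥ y' + star y ⬝ᵥ (Aᴴ *ᵥ x') := by
    intro x y x' y'
    have : star (Sum.elim x y) = Sum.elim (star x) (star y) := by ext (i | i) <;> rfl
    rw [matForm_apply, matN, fromBlocks_mulVec, this, sumElim_dotProduct_sumElim, matForm_apply,
      ← star_dotProduct_mulVec]
    simp [dotProduct_add]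
  have hdec : ∀ z : Fin m ⊕ Fin n → ℂ, z = Sum.elim (z ∘ Sum.inl) (z ∘ Sum.inr) :=
    fun z => (Sum.elim_comp_inl_inr z).symm
  have hfun : ∀ z : Fin m ⊕ Fin n → ℂ,
      LinearMap.funLeft ℂ ℂ Sum.inl z = z ∘ Sum.inl := fun _ => rfl
  refine posIdx_bordered (isHerm_matForm hN) (l := LinearMap.funLeft ℂ ℂ Sum.inl)
    (LinearMap.funLeft_surjective_of_injective ℂ ℂ _ Sum.inl_injective) ?_ ?_ ?_ ?_
  · intro z hz
    have hz' := mem_coker.1 hz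
    rw [hfun] at hz' ⊢
    rw [hdec z, happ]
    simp [hz']
  · intro z hz z' hz'
    have hz' := mem_coker.1 hz'
    rw [hfun] at hz' hz
    rw [hdec z, hdec z', happ, hz, hz']
    simp
  · have := rank_add_finrank_coker A
    rw [Module.finrank_fin_fun]
    omega
  · have h1 : LinearMap.ker (LinearMap.funLeft ℂ ℂ (Sum.inl : Fin m → Fin m ⊕ Fin n)) ⊓
        rad (matForm (matN A C)) ⊤ = (LinearMap.ker A.mulVecLin).map (inrVec (Fin m) (Fin n)) := by
      ext z
      constructor
      · rintro ⟨h0, hz⟩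
        have h0 : z ∘ Sum.inl = 0 := h0
        rw [SetLike.mem_coe, mem_rad_matForm_top hN, matN, fromBlocks_mulVec, h0] at hz
        refine ⟨z ∘ Sum.inr, ?_, ?_⟩
        · have := congrArg (· ∘ Sum.inl) hz
          simpa using this
        · rw [hdec z, h0]; rfl
      · rintro ⟨y, hy, rfl⟩
        have hy : A *ᵥ y = 0 := hy
        refine ⟨rfl, ?_⟩
        rw [SetLike.mem_coe, mem_rad_matForm_top hN, matN, fromBlocks_mulVec]
        ext (i | i) <;> simp [inrVec, hy]
    rw [h1, finrank_map_of_injective (inrVec_injective _ _), finrank_ker_funLeft_inl,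
      Fintype.card_fin]
    have := rank_add_finrank_ker_fin A
    omega

theorem negIdx_matN (hC : C.IsHermitian) :
    posIdx (-matForm (matN A C)) ⊤ = A.rank + posIdx (matForm (-C)) (coker A) := by
  have hA : coker (-A) = coker A := by
    ext x
    simp [mem_coker, neg_mulVec]
  have hr : (-A).rank = A.rank := by
    have h1 := rank_add_finrank_coker A
    have h2 := rank_add_finrank_coker (-A)
    rw [hA] at h2
    omega
  have hN : -matN A C = matN (-A) (-C) := by
    rw [matN, matN, fromBlocks_neg, conjTranspose_neg, neg_zero]
  rw [← matForm_neg, hN, posIdx_matN hC.neg, hA, hr]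

theorem finrank_ker_eq {ι κ : Type*} [Fintype ι] [Fintype κ]
    {S : Submodule ℂ (ι ⊕ κ → ℂ)} {W : Submodule ℂ (ι → ℂ)} {T : Submodule ℂ (κ → ℂ)}
    (hW : ∀ x, x ∈ W ↔ ∃ y, Sum.elim x y ∈ S) (hT : ∀ y, y ∈ T ↔ Sum.elim (0 : ι → ℂ) y ∈ S) :
    finrank ℂ S = finrank ℂ W + finrank ℂ T := by
  have h := finrank_map_add_finrank_inf_ker (LinearMap.funLeft ℂ ℂ (Sum.inl : ι → ι ⊕ κ)) S
  have h1 : S.map (LinearMap.funLeft ℂ ℂ (Sum.inl : ι → ι ⊕ κ)) = W := by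
    ext x
    rw [hW]
    constructor
    · rintro ⟨z, hz, rfl⟩
      exact ⟨z ∘ Sum.inr, by
        rw [show LinearMap.funLeft ℂ ℂ Sum.inl z = z ∘ Sum.inl from rfl,
          Sum.elim_comp_inl_inr]; exact hz⟩
    · rintro ⟨y, hy⟩
      exact ⟨_, hy, rfl⟩
  have h2 : S ⊓ LinearMap.ker (LinearMap.funLeft ℂ ℂ (Sum.inl : ι → ι ⊕ κ))
      = T.map (inrVec ι κ) := by
    ext z
    constructor
    · rintro ⟨hz, h0⟩
      have h0 : z ∘ Sum.inl = 0 := h0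
      have hz' : z = Sum.elim (0 : ι → ℂ) (z ∘ Sum.inr) := by rw [← h0, Sum.elim_comp_inl_inr]
      refine ⟨z ∘ Sum.inr, (hT _).2 ?_, hz'.symm⟩
      rw [← hz']; exact hz
    · rintro ⟨y, hy, rfl⟩
      exact ⟨(hT y).1 hy, rfl⟩
  rw [h1, h2, finrank_map_of_injective (inrVec_injective _ _)] at h
  exact h.symm

theorem rank_fromCols (hB : B.IsHermitian) (hC : C.IsHermitian) :
    (fromCols A (B - C)).rank
      + finrank ℂ (coker A ⊓ rad (matForm (B - C)) ⊤ : Submodule ℂ (Fin m → ℂ)) = m := by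
  have h := rank_add_finrank_ker_conjTranspose (fromCols A (B - C))
  have h1 : LinearMap.ker (fromCols A (B - C))ᴴ.mulVecLin
      = coker A ⊓ rad (matForm (B - C)) ⊤ := by
    ext x
    rw [Submodule.mem_inf, mem_rad_matForm_top (hB.sub hC), mem_coker, LinearMap.mem_ker,
      mulVecLin_apply, conjTranspose_fromCols_eq_fromRows_conjTranspose, fromRows_mulVec,
      (hB.sub hC).eq, ← Sum.elim_zero_zero, Sum.elim_eq_iff]
  rwa [h1, Fintype.card_fin] at h

/-- In the left kernel a single y serves both Bx + Ay = 0 and Cx + Ay = 0, forcing (B - C)x = 0; the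
fibre over x is a translate of ker A. -/
theorem rank_matK₂ (hB : B.IsHermitian) (hC : C.IsHermitian) :
    (matK₂ A B C).rank + finrank ℂ (rad (matForm (-C)) (coker A) ⊓ rad (matForm (B - C)) ⊤ :
      Submodule ℂ (Fin m → ℂ)) = m + A.rank := by
  have h := rank_add_finrank_ker_conjTranspose (matK₂ A B C)
  have hmem : ∀ x y, Sum.elim x y ∈ LinearMap.ker (matK₂ A B C)ᴴ.mulVecLin ↔
      B *ᵥ x + A *ᵥ y = 0 ∧ C *ᵥ x + A *ᵥ y = 0 ∧ Aᴴ *ᵥ x = 0 := by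
    intro x y
    rw [LinearMap.mem_ker, mulVecLin_apply, matK₂,
      conjTranspose_fromRows_eq_fromCols_conjTranspose, fromCols_mulVec_sumElim]
    simp only [conjTranspose_fromCols_eq_fromRows_conjTranspose, fromRows_mulVec,
      conjTranspose_conjTranspose, conjTranspose_zero, zero_mulVec, hB.eq, hC.eq,
      ← Sum.elim_add_add, add_zero]
    rw [← Sum.elim_zero_zero, Sum.elim_eq_iff, ← Sum.elim_zero_zero, Sum.elim_eq_iff]
  rw [finrank_ker_eq (W := rad (matForm (-C)) (coker A) ⊓ rad (matForm (B - C)) ⊤)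
    (T := LinearMap.ker A.mulVecLin) ?_ ?_, Fintype.card_sum, Fintype.card_fin,
    Fintype.card_fin] at h
  · have := rank_add_finrank_ker_fin A
    omega
  · intro x
    rw [Submodule.mem_inf, mem_rad_neg hC, mem_rad_matForm_top (hB.sub hC)]
    simp only [hmem, sub_mulVec]
    constructor
    · rintro ⟨⟨h1, y, hy⟩, h2⟩
      exact ⟨y, by rw [sub_eq_zero.1 h2, hy], hy, h1⟩
    · rintro ⟨y, h1, h2, h3⟩
      exact ⟨⟨h3, y, h2⟩, sub_eq_zero.2 (add_right_cancel (h1.trans h2.symm))⟩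
  · intro y
    rw [hmem]
    simp

/-- Here Bx and Cx have independent preimages under A, so (B - C)x need only be orthogonal to ker
A*; the fibre is a translate of ker A × ker A. -/
theorem rank_matK₁ (hB : B.IsHermitian) (hC : C.IsHermitian) :
    (matK₁ A B C).rank + finrank ℂ (rad (matForm (-C)) (coker A) ⊓
      rad (matForm (B - C)) (coker A) : Submodule ℂ (Fin m → ℂ)) = m + 2 * A.rank := by
  have h := rank_add_finrank_ker_conjTranspose (matK₁ A B C)
  have hmem : ∀ x y z,
      Sum.elim x (Sum.elim y z) ∈ LinearMap.ker (matK₁ A B C)ᴴ.mulVecLin ↔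
      B *ᵥ x + A *ᵥ y = 0 ∧ C *ᵥ x + A *ᵥ z = 0 ∧ Aᴴ *ᵥ x = 0 := by
    intro x y z
    rw [LinearMap.mem_ker, mulVecLin_apply, matK₁,
      conjTranspose_fromRows_eq_fromCols_conjTranspose, fromCols_mulVec_sumElim,
      conjTranspose_fromRows_eq_fromCols_conjTranspose, fromCols_mulVec_sumElim]
    simp only [conjTranspose_fromCols_eq_fromRows_conjTranspose, fromRows_mulVec,
      conjTranspose_conjTranspose, conjTranspose_zero, zero_mulVec, hB.eq, hC.eq,
      ← Sum.elim_add_add, add_zero, zero_add]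
    rw [← Sum.elim_zero_zero, Sum.elim_eq_iff, ← Sum.elim_zero_zero, Sum.elim_eq_iff]
  let T : Submodule ℂ (Fin n ⊕ Fin n → ℂ) :=
    (LinearMap.ker A.mulVecLin).comap (LinearMap.funLeft ℂ ℂ Sum.inl) ⊓
      (LinearMap.ker A.mulVecLin).comap (LinearMap.funLeft ℂ ℂ Sum.inr)
  have hTmem : ∀ y z, Sum.elim y z ∈ T ↔ A *ᵥ y = 0 ∧ A *ᵥ z = 0 := fun _ _ => Iff.rfl
  have hdec : ∀ y : Fin n ⊕ Fin n → ℂ, y = Sum.elim (y ∘ Sum.inl) (y ∘ Sum.inr) :=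
    fun y => (Sum.elim_comp_inl_inr y).symm
  have hT : finrank ℂ T = finrank ℂ (LinearMap.ker A.mulVecLin)
      + finrank ℂ (LinearMap.ker A.mulVecLin) := by
    refine finrank_ker_eq (fun x => ?_) (fun y => ?_)
    · simp only [hTmem]
      exact ⟨fun hx => ⟨0, hx, mulVec_zero A⟩, fun ⟨_, hx, _⟩ => hx⟩
    · rw [hTmem]
      exact ⟨fun hx => ⟨mulVec_zero A, hx⟩, fun hx => hx.2⟩
  rw [finrank_ker_eq (W := rad (matForm (-C)) (coker A) ⊓ rad (matForm (B - C)) (coker A))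
    (T := T) ?_ ?_, hT, Fintype.card_sum, Fintype.card_sum, Fintype.card_fin,
    Fintype.card_fin] at h
  · have := rank_add_finrank_ker_fin A
    omega
  · intro x
    have h1 : x ∈ rad (matForm (-C)) (coker A) ⊓ rad (matForm (B - C)) (coker A) ↔
        x ∈ rad (matForm (-C)) (coker A) ⊓ rad (matForm (-B)) (coker A) := by
      simp only [Submodule.mem_inf]
      refine and_congr_right fun hx => ?_
      rw [mem_rad, mem_rad]
      refine and_congr_right fun hxU => forall₂_congr fun u hu => ?_
      have := hx.2 u hu
      rw [matForm_neg, LinearMap.neg_apply, LinearMap.neg_apply, neg_eq_zero] at this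
      rw [matForm_sub_apply, matForm_neg, this]
      simp
    rw [h1, Submodule.mem_inf, mem_rad_neg hC, mem_rad_neg hB]
    constructor
    · rintro ⟨⟨h1, y, hy⟩, -, z, hz⟩
      exact ⟨Sum.elim z y, (hmem _ _ _).2 ⟨hz, hy, h1⟩⟩
    · rintro ⟨y, hy⟩
      rw [hdec y, hmem] at hy
      exact ⟨⟨hy.2.2, _, hy.2.1⟩, hy.2.2, _, hy.1⟩
  · intro y
    rw [hdec y, hmem, hTmem]
    simp

end MainProof

end LMI

/-! ### Assembly of the numerical invariants -/

namespace LMI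

open Module Matrix
open scoped ComplexOrder

section Assembly

variable {m n : ℕ} {A : Matrix (Fin m) (Fin n) ℂ} {B C : Matrix (Fin m) (Fin m) ℂ}

theorem iPos_eq {ι : Type*} [Fintype ι] [DecidableEq ι] {M : Matrix ι ι ℂ}
    (hM : M.IsHermitian) : iPos M = posIdx (matForm M) ⊤ := by
  rw [iPos, posIdx_matForm hM]

theorem iNeg_eq {ι : Type*} [Fintype ι] [DecidableEq ι] {M : Matrix ι ι ℂ}
    (hM : M.IsHermitian) : iNeg M = posIdx (-matForm M) ⊤ := by
  rw [iNeg, negIdx_matForm hM]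

theorem rk_eq_add {ι : Type*} [Fintype ι] [DecidableEq ι] {M : Matrix ι ι ℂ}
    (hM : M.IsHermitian) : rk M = iPos M + iNeg M := by
  rw [rk, rank_eq_add hM, iPos_eq hM, iNeg_eq hM]
  push_cast
  rfl

theorem posDef_iff_iPos {M : Matrix (Fin m) (Fin m) ℂ} (hM : M.IsHermitian) :
    M.PosDef ↔ (m : ℤ) ≤ iPos M := by
  rw [posDef_iff hM, iPos_eq hM, Fintype.card_fin, Nat.cast_le]

theorem neg_posDef_iff_iNeg {M N : Matrix (Fin m) (Fin m) ℂ} (hM : M.IsHermitian)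
    (hN : N.IsHermitian) : (M - N).PosDef ↔ (m : ℤ) ≤ iNeg (N - M) := by
  rw [posDef_iff (hM.sub hN), iNeg_eq (hN.sub hM), Fintype.card_fin, Nat.cast_le, ← matForm_neg,
    neg_sub]

theorem posSemidef_iff_iNeg {M : Matrix (Fin m) (Fin m) ℂ} (hM : M.IsHermitian) :
    M.PosSemidef ↔ iNeg M = 0 := by
  rw [posSemidef_iff hM, iNeg_eq hM, Nat.cast_eq_zero]

theorem neg_posSemidef_iff_iPos {M N : Matrix (Fin m) (Fin m) ℂ} (hM : M.IsHermitian)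
    (hN : N.IsHermitian) : (M - N).PosSemidef ↔ iPos (N - M) = 0 := by
  rw [posSemidef_iff (hM.sub hN), iPos_eq (hN.sub hM), Nat.cast_eq_zero, ← matForm_neg, neg_sub]

theorem isGreatest_image {α : Type*} {f : α → ℤ} {S : Set α} {k : ℤ} (h : ∀ x ∈ S, f x ≤ k)
    (h' : ∃ x ∈ S, k ≤ f x) : IsGreatest (f '' S) k := by
  obtain ⟨x, hx, hk⟩ := h'
  refine ⟨⟨x, hx, le_antisymm (h x hx) hk⟩, ?_⟩
  rintro _ ⟨y, hy, rfl⟩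
  exact h y hy

theorem isLeast_image {α : Type*} {f : α → ℤ} {S : Set α} {k : ℤ} (h : ∀ x ∈ S, k ≤ f x)
    (h' : ∃ x ∈ S, f x ≤ k) : IsLeast (f '' S) k := by
  obtain ⟨x, hx, hk⟩ := h'
  refine ⟨⟨x, hx, le_antisymm hk (h x hx)⟩, ?_⟩
  rintro _ ⟨y, hy, rfl⟩
  exact h y hy

theorem iPos_matN (hC : C.IsHermitian) :
    iPos (matN A C) = A.rank + posIdx (-matForm (-C)) (coker A) := by
  rw [iPos_eq (isHermitian_matN A hC), posIdx_matN hC, matForm_neg, neg_neg]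
  push_cast
  rfl

theorem iNeg_matN (hC : C.IsHermitian) :
    iNeg (matN A C) = A.rank + posIdx (matForm (-C)) (coker A) := by
  rw [iNeg_eq (isHermitian_matN A hC), negIdx_matN hC]
  push_cast
  rfl

/-- The invariants that govern the extremal ranks and indices, the bounds they impose on all
solutions, and solutions that attain these bounds. -/
theorem exists_invariants (hB : B.IsHermitian) (hC : C.IsHermitian) (hS : (solSet A B).Nonempty) :
    ∃ a b p q κ d e u₀ u₁ u₂ : ℤ,
      (a + b = m ∧ p + q + κ = b ∧ 0 ≤ p ∧ 0 ≤ q ∧ 0 ≤ d ∧ 0 ≤ a ∧ 0 ≤ u₀ ∧ u₀ ≤ u₁ ∧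
        u₀ ≤ u₂ ∧
        e + u₁ ≤ m ∧ (d = 0 → u₂ ≤ u₀)) ∧
      (rk A = a ∧ rk (matK₁ A B C) = m + 2 * a - u₂ ∧ rk (matK₂ A B C) = m + a - u₀ ∧
        rk (fromCols A (B - C)) = m - u₁) ∧
      (iPos (matN A C) = a + q ∧ iNeg (matN A C) = a + p ∧ iPos (B - C) = d ∧
        iNeg (B - C) = e) ∧
      (∀ X ∈ solSet A B, iPos (lyap A X - C) ≤ a + p ∧ iNeg (lyap A X - C) ≤ a + q ∧
        iNeg (lyap A X - C) ≤ e ∧ p + u₂ - u₀ ≤ iPos (lyap A X - C) ∧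
        d + u₁ - u₀ ≤ iPos (lyap A X - C) ∧ q + u₂ - u₀ ≤ iNeg (lyap A X - C) ∧
        iPos (lyap A X - C) + iNeg (lyap A X - C) ≤ m - u₀) ∧
      (∃ X ∈ solSet A B, a + p ≤ iPos (lyap A X - C) ∧
        min a (κ - u₀) + q ≤ iNeg (lyap A X - C)) ∧
      (∃ X ∈ solSet A B, min e (a + q) ≤ iNeg (lyap A X - C)) ∧
      (∃ X ∈ solSet A B, iPos (lyap A X - C) ≤ max (p + u₂ - u₀) (d + u₁ - u₀) ∧
        iNeg (lyap A X - C) ≤ q + u₂ - u₀) := by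
  have hD := hB.sub hC
  have hM : ∀ X, (lyap A X - C).IsHermitian := fun X => (isHermitian_lyap A X).sub hC
  have hDf := isHerm_matForm hD
  have hEf := isHerm_matForm hC.neg
  have hext : ∀ X ∈ solSet A B, _ := fun X hX => isExtension_of_mem_solSet hB hC hX
  have hDE : ∀ x ∈ coker A, (matForm (B - C) x x).re ≤ (matForm (-C) x x).re := by
    obtain ⟨X, hX⟩ := hS
    intro x hx
    rw [← (hext X hX).agree x hx x hx]
    exact (hext X hX).dom x trivial
  have hfin : finrank ℂ (Fin m → ℂ) = m := finrank_fin_fun ℂ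
  have ha := rank_add_finrank_coker A
  have ha' : finrank ℂ (coker A) + A.rank = finrank ℂ (Fin m → ℂ) := by omega
  have hE := posIdx_add_negIdx_add_rad hEf (coker A)
  have hr1 := rank_matK₁ (A := A) hB hC
  have hr2 := rank_matK₂ (A := A) hB hC
  have hr3 := rank_fromCols (A := A) hB hC
  have hu0 : finrank ℂ (rad (matForm (-C)) (coker A) ⊓ rad (matForm (B - C)) ⊤ :
        Submodule ℂ (Fin m → ℂ))
      ≤ finrank ℂ (rad (matForm (-C)) (coker A) ⊓ rad (matForm (B - C)) (coker A) :
        Submodule ℂ (Fin m → ℂ)) :=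
    Submodule.finrank_mono fun x hx => ⟨hx.1, hx.1.1, fun u _ => hx.2.2 u trivial⟩
  have hu1 : finrank ℂ (rad (matForm (-C)) (coker A) ⊓ rad (matForm (B - C)) ⊤ :
        Submodule ℂ (Fin m → ℂ))
      ≤ finrank ℂ (coker A ⊓ rad (matForm (B - C)) ⊤ : Submodule ℂ (Fin m → ℂ)) :=
    Submodule.finrank_mono (inf_le_inf_right _ (rad_le _ _))
  have hu2 : finrank ℂ (rad (matForm (-C)) (coker A) ⊓ rad (matForm (B - C)) ⊤ :
        Submodule ℂ (Fin m → ℂ))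
      ≤ finrank ℂ (rad (matForm (-C)) (coker A)) :=
    Submodule.finrank_mono inf_le_left
  have hu02 := finrank_rad_inf_rad_le (E := matForm (-C)) (U := coker A) hDf
  -- This is e + u₁ ≤ m, which makes the terms containing -m irrelevant.
  have hdn := posIdx_add_finrank_le_of_nonpos (D := -matForm (B - C))
    (le_top (a := coker A ⊓ rad (matForm (B - C)) ⊤))
    (fun x hx => by simp [hx.2.2 x trivial])
  rw [finrank_top, hfin] at hdn
  -- At most a steps are available, and only κ - u₀ dimensions of rad E|U can be paired off through
  -- D.
  have hmax := exists_extension_posIdx_ge hDf A.rank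
    (min A.rank (finrank ℂ (rad (matForm (-C)) (coker A)) -
      finrank ℂ (rad (matForm (-C)) (coker A) ⊓ rad (matForm (B - C)) ⊤ :
        Submodule ℂ (Fin m → ℂ))))
    _ _ ha' hEf hDE (min_le_left _ _) (by omega)
  have hneg := exists_extension_negIdx_ge hDf
    (min (posIdx (-matForm (B - C)) ⊤) (A.rank + posIdx (-matForm (-C)) (coker A)))
    (min_le_left _ _) _ _ _ ha' hEf hDE (min_le_right _ _)
  have hmin := fun x y => exists_extension_idx_le hDf x y A.rank _ _ ha' hEf hDE
  have iM : ∀ X, iPos (lyap A X - C) = _ := fun X => iPos_eq (hM X)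
  have jM : ∀ X, iNeg (lyap A X - C) = _ := fun X => iNeg_eq (hM X)
  have hpos := fun X hX => posIdx_extension_add_le (hext X hX)
  have hneg' := fun X hX => negIdx_extension_add_le (hext X hX)
  have hnegD := fun X hX => negIdx_extension_le (hext X hX)
  have hle1 := fun X hX => le_posIdx_extension hDf (hext X hX)
  have hle2 := fun X hX => posIdx_dominated_add_le hDf (hext X hX)
  have hle3 := fun X hX => le_negIdx_extension hDf (hext X hX)
  have hrad := fun X hX => finrank_rad_le_extension hDf (hext X hX)
  have hsum := fun X hX => posIdx_add_negIdx_add_rad (hext X hX).herm ⊤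
  rw [hfin] at hpos hneg'
  rw [finrank_top, hfin] at hsum
  refine ⟨((A.rank : ℕ) : ℤ),
    ((finrank ℂ (coker A) : ℕ) : ℤ),
    ((posIdx (matForm (-C)) (coker A) : ℕ) : ℤ),
    ((posIdx (-matForm (-C)) (coker A) : ℕ) : ℤ),
    ((finrank ℂ (rad (matForm (-C)) (coker A)) : ℕ) : ℤ),
    ((posIdx (matForm (B - C)) ⊤ : ℕ) : ℤ),
    ((posIdx (-matForm (B - C)) ⊤ : ℕ) : ℤ),
    ((finrank ℂ (rad (matForm (-C)) (coker A) ⊓ rad (matForm (B - C)) ⊤ : Submodule ℂ (Fin m → ℂ)) : ℕ) : ℤ),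
    ((finrank ℂ (coker A ⊓ rad (matForm (B - C)) ⊤ : Submodule ℂ (Fin m → ℂ)) : ℕ) : ℤ),
    ((finrank ℂ (rad (matForm (-C)) (coker A) ⊓ rad (matForm (B - C)) (coker A) : Submodule ℂ (Fin m → ℂ)) : ℕ) : ℤ),
    ⟨by exact_mod_cast ha, by exact_mod_cast hE,
    Nat.cast_nonneg _, Nat.cast_nonneg _, Nat.cast_nonneg _, Nat.cast_nonneg _,
    Nat.cast_nonneg _,
    by exact_mod_cast hu1, by exact_mod_cast hu0, by exact_mod_cast hdn, by exact_mod_cast hu02⟩,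
    ⟨rfl, ?_, ?_, ?_⟩, ⟨iPos_matN hC, iNeg_matN hC, iPos_eq hD, iNeg_eq hD⟩, fun X hX => ?_,
    ?_, ?_, ?_⟩
  · rw [rk]; omega
  · rw [rk]; omega
  · rw [rk]; omega
  · rw [iM, jM]
    refine ⟨?_, ?_, ?_, ?_, ?_, ?_, ?_⟩
    · have := hpos X hX; omega
    · have := hneg' X hX; omega
    · exact_mod_cast hnegD X hX
    · have := hle1 X hX; omega
    · have := hle2 X hX; omega
    · have := hle3 X hX; omega
    · have := hrad X hX
      have := hsum X hX
      omega
  · obtain ⟨F, hF, h1, h2⟩ := hmax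
    obtain ⟨X, hX, rfl⟩ := exists_mem_solSet hB hC hF
    refine ⟨X, hX, ?_, ?_⟩
    · rw [iM]; exact_mod_cast h1
    · rw [jM, ← Nat.cast_sub hu2]; exact_mod_cast h2
  · obtain ⟨F, hF, h1⟩ := hneg
    obtain ⟨X, hX, rfl⟩ := exists_mem_solSet hB hC hF
    exact ⟨X, hX, by rw [jM]; exact_mod_cast h1⟩
  · obtain ⟨F, hF, h1, h2⟩ := hmin
      (max (posIdx (matForm (-C)) (coker A) + finrank ℂ (rad (matForm (-C)) (coker A) ⊓
        rad (matForm (B - C)) (coker A) : Submodule ℂ (Fin m → ℂ)))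
      (posIdx (matForm (B - C)) ⊤ + finrank ℂ (coker A ⊓
        rad (matForm (B - C)) ⊤ : Submodule ℂ (Fin m → ℂ))) -
      finrank ℂ (rad (matForm (-C)) (coker A) ⊓ rad (matForm (B - C)) ⊤ :
        Submodule ℂ (Fin m → ℂ)))
      (posIdx (-matForm (-C)) (coker A) + finrank ℂ (rad (matForm (-C)) (coker A) ⊓
        rad (matForm (B - C)) (coker A) : Submodule ℂ (Fin m → ℂ)) -
      finrank ℂ (rad (matForm (-C)) (coker A) ⊓ rad (matForm (B - C)) ⊤ :
        Submodule ℂ (Fin m → ℂ)))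
      (by omega) (by omega) (by omega)
    obtain ⟨X, hX, rfl⟩ := exists_mem_solSet hB hC hF
    refine ⟨X, hX, ?_, ?_⟩
    · rw [iM]; omega
    · rw [jM]; omega

end Assembly

end LMI

/-! ### The extremal values and the solvability criteria -/

theorem mainTheorem6 (m n : ℕ) (A : Matrix (Fin m) (Fin n) ℂ) (B C : Matrix (Fin m) (Fin m) ℂ)
    (hB : B.IsHermitian) (hC : C.IsHermitian) (hS : (LMI.solSet A B).Nonempty)
    (N : Matrix (Fin m ⊕ Fin n) (Fin m ⊕ Fin n) ℂ) (hN : N = LMI.matN A C)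
    (K₁ : Matrix (Fin m ⊕ (Fin n ⊕ Fin n)) (Fin m ⊕ (Fin m ⊕ Fin n)) ℂ)
    (hK₁ : K₁ = LMI.matK₁ A B C)
    (K₂ : Matrix (Fin m ⊕ Fin n) (Fin m ⊕ (Fin m ⊕ Fin n)) ℂ)
    (hK₂ : K₂ = LMI.matK₂ A B C)
    (t₁ t₂ t₃ t₄ : ℤ)
    (ht₁ : t₁ = 2 * LMI.rk K₂ + LMI.rk N - 2 * LMI.rk K₁)
    (ht₂ : t₂ = 2 * LMI.rk K₂ + LMI.rk (B - C) - 2 * LMI.rk (Matrix.fromCols A (B - C))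
      - 2 * LMI.rk A - m)
    (ht₃ : t₃ = 2 * LMI.rk K₂ + LMI.iPos N + LMI.iPos (B - C) - LMI.rk A
      - LMI.rk (Matrix.fromCols A (B - C)) - LMI.rk K₁)
    (ht₄ : t₄ = 2 * LMI.rk K₂ + LMI.iNeg N + LMI.iNeg (B - C) - LMI.rk A
      - LMI.rk (Matrix.fromCols A (B - C)) - LMI.rk K₁ - m) :
    -- maximal and minimal rank
    IsGreatest ((fun X => LMI.rk (LMI.lyap A X - C)) '' LMI.solSet A B)
      (min (LMI.rk K₂ - LMI.rk A) (LMI.rk N)) ∧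
    IsLeast ((fun X => LMI.rk (LMI.lyap A X - C)) '' LMI.solSet A B)
      (max (max t₁ t₂) (max t₃ t₄)) ∧
    -- maximal partial inertias
    IsGreatest ((fun X => LMI.iPos (LMI.lyap A X - C)) '' LMI.solSet A B) (LMI.iNeg N) ∧
    IsGreatest ((fun X => LMI.iNeg (LMI.lyap A X - C)) '' LMI.solSet A B)
      (min (LMI.iNeg (B - C)) (LMI.iPos N)) ∧
    -- minimal partial inertias
    IsLeast ((fun X => LMI.iPos (LMI.lyap A X - C)) '' LMI.solSet A B)
      (max (LMI.rk K₂ + LMI.iNeg N - LMI.rk K₁)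
        (LMI.rk K₂ + LMI.iPos (B - C) - LMI.rk (Matrix.fromCols A (B - C)) - LMI.rk A)) ∧
    IsLeast ((fun X => LMI.iNeg (LMI.lyap A X - C)) '' LMI.solSet A B)
      (max (LMI.rk K₂ + LMI.iPos N - LMI.rk K₁)
        (LMI.rk K₂ + LMI.iNeg (B - C) - LMI.rk (Matrix.fromCols A (B - C)) - LMI.rk A - m)) ∧
    -- (a)
    ((∃ X : Matrix (Fin n) (Fin m) ℂ,
        LMI.LoewnerGT C (LMI.lyap A X) ∧ LMI.LoewnerGE (LMI.lyap A X) B) ↔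
      (m : ℤ) ≤ LMI.iPos N ∧ LMI.LoewnerGT C B) ∧
    -- (b)
    ((∃ X : Matrix (Fin n) (Fin m) ℂ,
        LMI.LoewnerGE (LMI.lyap A X) B ∧ LMI.LoewnerGT (LMI.lyap A X) C) ↔
      (m : ℤ) ≤ LMI.iNeg N) ∧
    -- (c)
    ((∃ X : Matrix (Fin n) (Fin m) ℂ,
        LMI.LoewnerGE (LMI.lyap A X) B ∧ LMI.LoewnerGE (LMI.lyap A X) C) ↔
      LMI.rk K₂ + LMI.iPos N - LMI.rk K₁ = 0 ∧
        LMI.rk K₂ + LMI.iNeg (B - C) ≤ LMI.rk (Matrix.fromCols A (B - C)) + LMI.rk A + m) ∧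
    -- (d)
    ((∃ X : Matrix (Fin n) (Fin m) ℂ,
        LMI.LoewnerGE C (LMI.lyap A X) ∧ LMI.LoewnerGE (LMI.lyap A X) B) ↔
      LMI.LoewnerGE C B ∧ LMI.iNeg N = LMI.rk A ∧
        LMI.rk K₂ = LMI.rk (Matrix.fromCols A (B - C)) + LMI.rk A) := by
  subst hN hK₁ hK₂
  have hM : ∀ X, (LMI.lyap A X - C).IsHermitian := fun X => (LMI.isHermitian_lyap A X).sub hC
  obtain ⟨a, b, p, q, κ, d, e, u₀, u₁, u₂, ⟨h1, h2, h3, h4, h5, h6, hu₀, h7, h8, h9, h10⟩,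
    ⟨rA, r₁, r₂, r₃⟩, ⟨iN, jN, iD, jD⟩, hbound, ⟨X₁, hX₁, hp₁, hn₁⟩, ⟨X₂, hX₂, hn₂⟩,
    ⟨X₃, hX₃, hp₃, hn₃⟩⟩ := LMI.exists_invariants hB hC hS
  have rN := LMI.rk_eq_add (LMI.isHermitian_matN A hC)
  have rD := LMI.rk_eq_add (hB.sub hC)
  rw [iN, jN] at rN
  rw [iD, jD] at rD
  rw [r₂, rN, r₁] at ht₁
  rw [r₂, rD, r₃, rA] at ht₂
  rw [r₂, iN, iD, rA, r₃, r₁] at ht₃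
  rw [r₂, jN, jD, rA, r₃, r₁] at ht₄
  rw [rN, r₁, r₂, r₃, rA, iN, jN, iD, jD]
  -- Here t₁ and t₃ are q + u₂ - u₀ plus one of the two lower bounds for i₊, while e + u₁ ≤ m gives
  -- t₂ ≤ t₃ and t₄ ≤ t₁.
  have ht : max (max t₁ t₂) (max t₃ t₄) = max (p + u₂ - u₀) (d + u₁ - u₀) + (q + u₂ - u₀) := by
    subst ht₁ ht₂ ht₃ ht₄
    clear hbound hp₁ hn₁ hn₂ hp₃ hn₃ iN jN iD jD rN rD rA r₁ r₂ r₃ h10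
    omega
  rw [ht]
  clear ht ht₁ ht₂ ht₃ ht₄ iN jN rN rD rA r₁ r₂ r₃
  have H1 : IsGreatest ((fun X => LMI.rk (LMI.lyap A X - C)) '' LMI.solSet A B)
      (min ((m + a - u₀) - a) ((a + q + (a + p)))) := by
    refine LMI.isGreatest_image (fun X hX => ?_) ⟨X₁, hX₁, ?_⟩
    · have := hbound X hX
      rw [LMI.rk_eq_add (hM _)]
      omega
    -- The two indices at `X₁` sum to at least a + p + q + min(a, κ - u₀), and a + p + q + κ = m.
    · rw [LMI.rk_eq_add (hM _)]
      omega
  have H2 : IsLeast ((fun X => LMI.rk (LMI.lyap A X - C)) '' LMI.solSet A B)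
      (max (p + u₂ - u₀) (d + u₁ - u₀) + (q + u₂ - u₀)) := by
    refine LMI.isLeast_image (fun X hX => ?_) ⟨X₃, hX₃, ?_⟩
    · have := hbound X hX
      rw [LMI.rk_eq_add (hM _)]
      omega
    · rw [LMI.rk_eq_add (hM _)]
      omega
  have H3 : IsGreatest ((fun X => LMI.iPos (LMI.lyap A X - C)) '' LMI.solSet A B)
      ((a + p)) := by
    refine LMI.isGreatest_image (fun X hX => ?_) ⟨X₁, hX₁, ?_⟩
    · have := hbound X hX
      omega
    · omega
  have H4 : IsGreatest ((fun X => LMI.iNeg (LMI.lyap A X - C)) '' LMI.solSet A B)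
      (min (e) ((a + q))) := by
    refine LMI.isGreatest_image (fun X hX => ?_) ⟨X₂, hX₂, ?_⟩
    · have := hbound X hX
      omega
    · omega
  have H5 : IsLeast ((fun X => LMI.iPos (LMI.lyap A X - C)) '' LMI.solSet A B)
      (max ((m + a - u₀) + (a + p) - (m + 2 * a - u₂))
        ((m + a - u₀) + d - (m - u₁)
          - a)) := by
    refine LMI.isLeast_image (fun X hX => ?_) ⟨X₃, hX₃, ?_⟩
    · have := hbound X hX
      omega
    · omega
  have H6 : IsLeast ((fun X => LMI.iNeg (LMI.lyap A X - C)) '' LMI.solSet A B)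
      (max ((m + a - u₀) + (a + q) - (m + 2 * a - u₂))
        ((m + a - u₀) + e - (m - u₁)
          - a - m)) := by
    refine LMI.isLeast_image (fun X hX => ?_) ⟨X₃, hX₃, ?_⟩
    · have := hbound X hX
      omega
    · omega
  refine ⟨H1, H2, H3, H4, H5, H6, ?_, ?_, ?_, ?_⟩
  · rw [LMI.LoewnerGT, LMI.neg_posDef_iff_iNeg hC hB, jD]
    constructor
    · rintro ⟨X, h1, h2⟩
      rw [LMI.LoewnerGT, LMI.neg_posDef_iff_iNeg hC (LMI.isHermitian_lyap A X)] at h1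
      have h3 := H4.2 ⟨X, h2, rfl⟩
      dsimp only at h3
      omega
    · rintro ⟨h1, h2⟩
      obtain ⟨X, hX, h3⟩ := H4.1
      dsimp only at h3
      refine ⟨X, ?_, hX⟩
      rw [LMI.LoewnerGT, LMI.neg_posDef_iff_iNeg hC (LMI.isHermitian_lyap A X)]
      omega
  · constructor
    · rintro ⟨X, h1, h2⟩
      rw [LMI.LoewnerGT, LMI.posDef_iff_iPos (hM X)] at h2
      exact h2.trans (H3.2 ⟨X, h1, rfl⟩)
    · intro h1
      obtain ⟨X, hX, h3⟩ := H3.1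
      dsimp only at h3
      refine ⟨X, hX, ?_⟩
      rw [LMI.LoewnerGT, LMI.posDef_iff_iPos (hM X), h3]
      exact h1
  · constructor
    · rintro ⟨X, h1, h2⟩
      rw [LMI.LoewnerGE, LMI.posSemidef_iff_iNeg (hM X)] at h2
      have h3 := H6.2 ⟨X, h1, rfl⟩
      dsimp only at h3
      omega
    · rintro ⟨h1, h2⟩
      obtain ⟨X, hX, h3⟩ := H6.1
      dsimp only at h3
      refine ⟨X, hX, ?_⟩
      rw [LMI.LoewnerGE, LMI.posSemidef_iff_iNeg (hM X)]
      omega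
  · rw [LMI.LoewnerGE, LMI.neg_posSemidef_iff_iPos hC hB, iD]
    constructor
    · rintro ⟨X, h1, h2⟩
      rw [LMI.LoewnerGE, LMI.neg_posSemidef_iff_iPos hC (LMI.isHermitian_lyap A X)] at h1
      have h3 := H5.2 ⟨X, h2, rfl⟩
      dsimp only at h3
      omega
    · rintro ⟨h1, h2, h4⟩
      obtain ⟨X, hX, h3⟩ := H5.1
      dsimp only at h3
      refine ⟨X, ?_, hX⟩
      rw [LMI.LoewnerGE, LMI.neg_posSemidef_iff_iPos hC (LMI.isHermitian_lyap A X)]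
      -- The rank condition only gives u₁ = u₀; the equality u₂ = u₀ comes from d = 0.
      have h11 := h10 h1
      omega
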